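/- A capacitated network $\mathcal N=(\nu,\epsilon,\mu,c,\mathcal A,S,R)$ is a finite directed acyclic multigraph with node set $\nu$ and edge set $\epsilon$, a finite message set $\mu=\{m_1,\dots,m_{|\mu|}\}$, positive integer edge capacities $c(e)$, a finite alphabet $\mathcal A$ with at least two letters, and maps $S,R:\nu\to 2^{\mu}$ giving the messages generated and demanded by each node. Assume that $\mathcal N$ is a multiple multicast network (each message is generated by exactly one node and demanded by at least one node) and is nondegenerate (for each demand of a message there is a directed path from the node generating it to the node demanding it, and no node both generates and demands the same message). A $(\hat k,n)$ fractional network code, with $\hat k=(k_1,\dots,k_{|\mu|})$ and $n$ positive integers, consists of a finite field $F$ with $|F|\ge|\mathcal A|$, for each edge $e=(x,y)$ a map producing the vector in $F^{nc(e)}$ carried by $e$ from the vectors in $F^{k_i}$ of the messages $m_i$ generated by $x$ and the vectors carried by the in-edges of $x$, and for each node $x$ and each $m_j\in R(x)$ a decoding map producing a vector in $F^{k_j}$ from the same data at $x$. It is a solution if for every assignment of vectors in $F^{k_i}$ to the messages $m_i$ each decoding map for $m_j$ returns the vector assigned to $m_j$. It is a routing code if each component of each edge and decoding map copies a fixed input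 component or is idle (identically $0$). A coordinate of an edge is active if its value is not the same for all message assignments. A routing solution is minimal if no $(\hat k,n)$ routing solution (over any admissible field) has a strictly smaller set of active coordinates. The network routing capacity region $\mathcal C_r\subset\mathbb R^{|\mu|}$ is the closure of the set of all vectors $(k_1/n,\dots,k_{|\mu|}/n)$ for which a $(\hat k,n)$ fractional routing solution exists. Let $\mathcal T_i$ be the set of Steiner trees for $m_i$: the edge sets $T$ forming a directed tree rooted at the node generating $m_i$ and containing all nodes that demand $m_i$. Let $\mathcal T=\mathcal T_1\sqcup\dots\sqcup\mathcal T_{|\mu|}$ (disjoint union), put $T(e)=1$ if $e\in T$ and $T(e)=0$ otherwise, and let $$\mathcal P=\Big\{x\in\mathbb R^{\mathcal T}:\ \sum_{T\in\mathcal T}T(e)\,x(T)\le c(e)\ \ \forall e\in\epsilon,\quad x\ge 0\Big\},\qquad \psi_r(x)=\Big(\sum_{T\in\mathcal T_1}x(T),\dots,\sum_{T\in\mathcal T_{|\mu|}}x(T)\Big).$$ Theorem. (1) $\mathcal C_r$ is a bounded rational polytope (the convex hull of finitely many points with rational coordinates) contained in $\mathbb R_{\ge 0}^{|\mu|}$.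 (2) Every minimal fractional routing solution decomposes into a Steiner-tree packing: one can choose for each coordinate $j\in\{1,\dots,k_i\}$ of each message $m_i$ a tree $T_{i,j}\in\mathcal T_i$ such that on each edge $e\in T_{i,j}$ exactly one coordinate carries the $j$-th coordinate of $m_i$, and every active coordinate of an edge $e$ carries the $j$-th coordinate of $m_i$ for some $(i,j)$ with $e\in T_{i,j}$. If $x(T)$, for $T\in\mathcal T_i$, denotes the number of $j$ with $T_{i,j}=T$, divided by $n$, then $x\in\mathcal P$ and $\psi_r(x)=(k_1/n,\dots,k_{|\mu|}/n)$. (3) $\mathcal P$ is a bounded rational polytope and $\mathcal C_r=\psi_r(\mathcal P)$. (4) $\mathcal C_r$ is computable: there is a single computable function which, given a finite description of such a network, outputs a finite list of rational vectors that are exactly the vertices (extreme points) of $\mathcal C_r$; $\mathcal C_r$ is their convex hull. -/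

import Mathlib

/-- A capacitated network `(ν, ε, μ, c, 𝒜, S, R)`: a directed acyclic multigraph with node set `ν`
and edge set `ε` (the edge `e` goes from `src e` to `tgt e`), message set `μ`, positive integer edge
capacities `c`, an alphabet `𝒜` with at least two elements, the messages `S x` generated by the node
`x` and the messages `R x` demanded by the node `x`.  Finiteness of `ν`, `ε`, `μ` is assumed through
instances where the network is used; the field `two_le_alphabet` makes `𝒜` finite,
because `Nat.card` of an infinite type is `0`. -/
structure CapacitatedNetwork (ν ε μ 𝒜 : Type*) where
  src : ε → ν
  tgt : ε → ν
  c : ε → ℕ+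
  S : ν → Finset μ
  R : ν → Finset μ
  two_le_alphabet : 2 ≤ Nat.card 𝒜
  acyclic : ∀ x, ¬ Relation.TransGen (fun y z => ∃ e, src e = y ∧ tgt e = z) x x

namespace CapacitatedNetwork

variable {ν ε μ 𝒜 : Type*} (N : CapacitatedNetwork ν ε μ 𝒜)

/-- `y` can be reached from `x` by a directed path (possibly of length zero) whose edges lie in
the edge set `E`. -/
def Reach (E : Set ε) (x y : ν) : Prop :=
  Relation.ReflTransGen (fun u v => ∃ e ∈ E, N.src e = u ∧ N.tgt e = v) x y

/-- For each demand of a message there is a directed path from a node generating the message to the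
node demanding it, and no node both generates and demands the same message. -/
def Nondegenerate : Prop :=
  (∀ x m, m ∈ N.R x → ∃ y, m ∈ N.S y ∧ N.Reach Set.univ y x) ∧
    ∀ x m, m ∈ N.S x → m ∉ N.R x

/-- Every message is generated by exactly one node and demanded by at least one node. -/
def IsMultipleMulticast : Prop :=
  ∀ m, (∃! x, m ∈ N.S x) ∧ ∃ x, m ∈ N.R x

/-- The edge `e'` is an in-edge of the start node of `e`.  By acyclicity this is well-founded, so
that symbols can be assigned to edges by recursion. -/
theorem wellFounded_feeds [Finite ε] : WellFounded (fun e' e : ε => N.tgt e' = N.src e) := by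
  have hirr : Std.Irrefl (Relation.TransGen (fun e' e : ε => N.tgt e' = N.src e)) := by
    refine ⟨fun e he => N.acyclic (N.src e) ?_⟩
    have key : ∀ a b, Relation.TransGen (fun e' e : ε => N.tgt e' = N.src e) a b →
        Relation.TransGen (fun y z => ∃ e, N.src e = y ∧ N.tgt e = z) (N.src a) (N.src b) := by
      intro a b hab
      induction hab with
      | single h => exact .single ⟨a, rfl, h⟩
      | tail _ h ih => exact ih.tail ⟨_, rfl, h⟩
    exact key e e he
  have h : WellFounded (Relation.TransGen (fun e' e : ε => N.tgt e' = N.src e)) :=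
    Finite.wellFounded_of_trans_of_irrefl _
  exact h.mono fun _ _ hab => Relation.TransGen.single hab

/-- What is available at the node `x`: a vector in `F ^ (k m)` for each message `m` generated by `x`
and a vector in `F ^ (n * c e)` for each in-edge `e` of `x`. -/
abbrev NodeInput (F : Type) (k : μ → ℕ) (n : ℕ) (x : ν) :=
  ((m : {m // m ∈ N.S x}) → Fin (k m) → F) × ((e : {e // N.tgt e = x}) → Fin (n * N.c e) → F)

/-- A fractional network code `(F, k, n, ℱ_e, ℱ_d)` over the finite field `F` with `|F| ≥ |𝒜|`,
with source dimension vector `k` and edge dimension `n`. -/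
structure FractionalCode (F : Type) [Field F] [Finite F] (k : μ → ℕ) (n : ℕ) where
  alphabet_le : Nat.card 𝒜 ≤ Nat.card F
  k_pos : ∀ m, 0 < k m
  n_pos : 0 < n
  edgeFn : ∀ e, N.NodeInput F k n (N.src e) → Fin (n * N.c e) → F
  decFn : ∀ x m, m ∈ N.R x → N.NodeInput F k n x → Fin (k m) → F

/-- A map on the input of the node `x` that only copies components: each component of the output
is a fixed component of a message generated by `x`, or a fixed component of an in-edge of `x`, or is
left idle, with the value `0`. -/
def CopiesComponents {F : Type} [Field F] {k : μ → ℕ} {n : ℕ} {x : ν} {d : ℕ}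
    (g : N.NodeInput F k n x → Fin d → F) : Prop :=
  ∀ t, (∃ m j, ∀ inp, g inp t = inp.1 m j) ∨ (∃ e i, ∀ inp, g inp t = inp.2 e i) ∨
    ∀ inp, g inp t = 0

namespace FractionalCode

variable {N} {F : Type} [Field F] [Finite F] {k : μ → ℕ} {n : ℕ} (C : N.FractionalCode F k n)

/-- The symbol function: the vector carried by each edge when the messages are given by the
assignment `a`. -/
noncomputable def symbol [Finite ε] (a : ∀ m, Fin (k m) → F) : ∀ e, Fin (n * N.c e) → F :=
  N.wellFounded_feeds.fix fun e s => C.edgeFn e (fun m => a m, fun e' => s e' e'.2)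

theorem symbol_eq [Finite ε] (a : ∀ m, Fin (k m) → F) (e : ε) :
    C.symbol a e = C.edgeFn e (fun m => a m, fun e' => C.symbol a e') :=
  N.wellFounded_feeds.fix_eq _ e

/-- Every demand is satisfied under every message assignment. -/
def IsSolution [Finite ε] : Prop :=
  ∀ (a : ∀ m, Fin (k m) → F) x m (h : m ∈ N.R x),
    C.decFn x m h (fun m => a m, fun e => C.symbol a e) = a m

/-- All edge and decoding functions copy input components to output components. -/
def IsRouting : Prop :=
  (∀ e, N.CopiesComponents (C.edgeFn e)) ∧ ∀ x m h, N.CopiesComponents (C.decFn x m h)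

/-- A coordinate of an edge is active if it actually carries a symbol, that is, if its value is not
the same for all message assignments. -/
def active [Finite ε] : Set (Σ e, Fin (n * N.c e)) :=
  {p | ∃ a b, C.symbol a p.1 p.2 ≠ C.symbol b p.1 p.2}

/-- The coordinate `t` of the edge `e` carries the `j`-th coordinate of the message `m`. -/
def Carries [Finite ε] (e : ε) (t : Fin (n * N.c e)) (m : μ) (j : Fin (k m)) : Prop :=
  ∀ a, C.symbol a e t = a m j

/-- A minimal fractional routing solution: a routing solution such that no `(k, n)` routing solution
has a strictly smaller set of active coordinates. -/
def IsMinimalRoutingSolution [Finite ε] : Prop :=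
  C.IsRouting ∧ C.IsSolution ∧
    ∀ (F' : Type) (_ : Field F') (_ : Finite F') (D : N.FractionalCode F' k n),
      D.IsRouting → D.IsSolution → ¬ D.active ⊂ C.active

end FractionalCode

/-- The achievable routing rate vectors `(k m / n)_m`. -/
def achievableRoutingRates [Finite ε] : Set (μ → ℝ) :=
  {r | ∃ (F : Type) (_ : Field F) (_ : Finite F) (k : μ → ℕ) (n : ℕ) (C : N.FractionalCode F k n),
    C.IsRouting ∧ C.IsSolution ∧ ∀ m, r m = (k m : ℝ) / n}

/-- The network routing capacity region `𝒞_r`. -/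
def routingRegion [Finite ε] : Set (μ → ℝ) := closure N.achievableRoutingRates

/-- The edge set `T` is a directed tree rooted at `s` that contains all nodes of `Z`:
no edge of `T` enters `s`, at most one edge of `T` enters any other node, every node touched by `T`
is reachable from `s` inside `T`, and so is every node of `Z`. -/
def IsSteinerTree (s : ν) (Z : Set ν) (T : Finset ε) : Prop :=
  (∀ e ∈ T, N.tgt e ≠ s) ∧ (∀ e ∈ T, ∀ e' ∈ T, N.tgt e = N.tgt e' → e = e') ∧
    (∀ e ∈ T, N.Reach T s (N.src e)) ∧ ∀ z ∈ Z, N.Reach T s z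

/-- The Steiner trees for the message `m`: rooted at a node generating `m` and spanning all nodes
that demand `m`. -/
abbrev SteinerTree (m : μ) : Type _ :=
  {T : Finset ε // ∃ s, m ∈ N.S s ∧ N.IsSteinerTree s {x | m ∈ N.R x} T}

noncomputable instance [Finite ε] (m : μ) : Fintype (N.SteinerTree m) := Fintype.ofFinite _

/-- The disjoint union over all messages of the sets of Steiner trees. -/
abbrev AllSteinerTrees : Type _ := Σ m, N.SteinerTree m

open Classical in
/-- The Steiner-tree packing polytope: `∑_T T(e) x(T) ≤ c(e)` for all edges `e`, and `x ≥ 0`. -/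
def packingPolytope [Finite ε] [Fintype μ] : Set (N.AllSteinerTrees → ℝ) :=
  {x | (∀ e, ∑ T, (if e ∈ T.2.1 then (1 : ℝ) else 0) * x T ≤ ((N.c e : ℕ) : ℝ)) ∧ ∀ T, 0 ≤ x T}

open Classical in
/-- The normalized usage vector of a choice `τ` of one Steiner tree for each coordinate of each
message: `x(T)` is the number of coordinates sent along `T`, divided by the edge dimension `n`. -/
noncomputable def treeUsage {N : CapacitatedNetwork ν ε μ 𝒜} {k : μ → ℕ} (n : ℕ)
    (τ : ∀ m, Fin (k m) → N.SteinerTree m) (T : N.AllSteinerTrees) : ℝ :=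
  ((Finset.univ.filter fun j => τ T.1 j = T.2).card : ℝ) / n

/-- The map summing the tree usage over the Steiner trees of each message. -/
noncomputable def usagePerMessage [Finite ε] : (N.AllSteinerTrees → ℝ) →ₗ[ℝ] (μ → ℝ) where
  toFun x m := ∑ T : N.SteinerTree m, x ⟨m, T⟩
  map_add' x y := by
    funext m
    simp [Finset.sum_add_distrib]
  map_smul' a x := by
    funext m
    simp [Finset.mul_sum]

end CapacitatedNetwork

/-- A bounded rational polytope: the convex hull of finitely many points with rational
coordinates. -/
def IsRationalPolytope {ι : Type*} (K : Set (ι → ℝ)) : Prop :=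
  ∃ V : Finset (ι → ℚ), K = convexHull ℝ ((fun v i => (v i : ℝ)) '' (V : Set (ι → ℚ)))

/-- Finite descriptions of networks: number of nodes, number of messages, size of the alphabet,
list of edges as triples (start node, end node, capacity), and the node-by-message membership
tables of the source and receiver mappings. -/
abbrev NetworkDescription : Type :=
  ℕ × ℕ × ℕ × List (ℕ × ℕ × ℕ) × List (List Bool) × List (List Bool)

/-- The description of a network whose nodes, edges, messages and letters are numbered. -/
def CapacitatedNetwork.description {v d p q : ℕ}
    (N : CapacitatedNetwork (Fin v) (Fin d) (Fin p) (Fin q)) : NetworkDescription :=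
  (v, p, q,
    List.ofFn fun e => ((N.src e : ℕ), (N.tgt e : ℕ), (N.c e : ℕ)),
    List.ofFn fun x => List.ofFn fun m => decide (m ∈ N.S x),
    List.ofFn fun x => List.ofFn fun m => decide (m ∈ N.R x))

/-- `l` is a list of `p` fractions (numerator, denominator) with positive denominators. -/
def IsFractionVector (p : ℕ) (l : List (ℕ × ℕ)) : Prop :=
  l.length = p ∧ ∀ z ∈ l, 0 < z.2

/-- The vector in `ℝ ^ p` whose coordinates are the fractions in the list `l`. -/
noncomputable def fractionVector (p : ℕ) (l : List (ℕ × ℕ)) : Fin p → ℝ :=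
  fun i => ((l.getD i (0, 1)).1 : ℝ) / ((l.getD i (0, 1)).2 : ℝ)

/-!
A routing code only moves message coordinates around. In a routing solution the edges that carry
the `j`-th coordinate of a message `m` therefore contain, for each node demanding `m`, a path from
the node generating `m`, and hence a Steiner tree for `m`
(`IsMultipleMulticast.exists_steinerTree_subset`, `FractionalCode.exists_trees_of_isSolution`).
Conversely, trees that respect the capacities give a routing solution that uses one coordinate for
each edge of each tree and nothing else (`exists_routingSolution_of_trees`); applied to the trees
of a minimal solution, this shows that the minimal solution has no other active coordinates
(`IsMinimalRoutingSolution.exists_trees`).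

So a positive vector `k` belongs to a routing solution with edge dimension `n` if and only if there
is an integral packing of Steiner trees for the capacities multiplied by `n`, with `k m` trees for
`m` (`HasTreePacking`). Dividing by `n` puts the achievable rates into the image of the packing
polytope, which is compact. For the converse, a fractional packing with positive rates is a limit
of rounded multiples of itself, and every packing is a limit of packings with positive rates
(`routingRegion_eq`).

The packing polytope is `{x | A x ≤ b}` for integral `b` and a matrix `A` with entries in `{-1, 0,
1}`. By Cramer's rule and the bound `d!` for the determinants of such matrices, all vertices of
such a polytope in dimension at most `d` have the common denominator `(d!)!`
(`vertexScale_mul_integral`), so they are rational and finite in number, and the Krein-Milman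
theorem finishes the proof that the polytope and its image are rational polytopes.

For the computation, let `q = (d!)!`, where `d` bounds twice the number of Steiner trees. Each
vertex of the region is `k / q` for an integral packing with edge dimension `q`. If such a point
is not a vertex, then some pair of packings with different rates has it as the midpoint of its
rates. The pairs of packings with this midpoint form, after multiplication by `q`, another
polytope of the above kind; one of its vertices has different rates, and is a pair of integral
packings with edge dimension `q * q` (`mem_extremePoints_routingRegion_iff`). So being a vertex is
decided by a bounded search for integral packings. To avoid computing with trees, the search is
for labellings of the edges by message coordinates (`NetworkDescription.IsLabelling`,
`feasible_description_iff`), and the resulting function is even primitive recursive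
(`NetworkDescription.primrec_vertexList`).
-/

/-! ### Vertices of integral polyhedra -/

section Polyhedra

variable {κ ι : Type*} [Fintype ι]

/-- The polyhedron of the solutions of the system `A x ≤ b` of linear inequalities with integer
coefficients. -/
def integralPolyhedron (A : κ → ι → ℤ) (b : κ → ℤ) : Set (ι → ℝ) :=
  {x | ∀ r, ∑ i, (A r i : ℝ) * x i ≤ b r}

theorem convex_integralPolyhedron (A : κ → ι → ℤ) (b : κ → ℤ) :
    Convex ℝ (integralPolyhedron A b) := by
  intro x hx y hy s t hs ht hst r
  have h1 := mul_le_mul_of_nonneg_left (hx r) hs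
  have h2 := mul_le_mul_of_nonneg_left (hy r) ht
  have h3 : ∑ i, (A r i : ℝ) * (s • x + t • y) i
      = s * ∑ i, (A r i : ℝ) * x i + t * ∑ i, (A r i : ℝ) * y i := by
    simp only [Finset.mul_sum, ← Finset.sum_add_distrib]
    refine Finset.sum_congr rfl fun i _ => ?_
    simp only [Pi.add_apply, Pi.smul_apply, smul_eq_mul]
    ring
  have h4 : s * (b r : ℝ) + t * b r = b r := by rw [← add_mul, hst, one_mul]
  linarith

theorem isClosed_integralPolyhedron (A : κ → ι → ℤ) (b : κ → ℤ) :
    IsClosed (integralPolyhedron A b) := by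
  simp only [integralPolyhedron, Set.ofPred_forall]
  exact isClosed_iInter fun r => isClosed_le (by fun_prop) continuous_const

/-- At a vertex the tight constraints have full rank: otherwise one could move from the vertex in
both directions along a line orthogonal to all tight rows. -/
theorem span_tight_eq_top [Finite κ] {A : κ → ι → ℤ} {b : κ → ℤ} {x : ι → ℝ}
    (hx : x ∈ (integralPolyhedron A b).extremePoints ℝ) :
    Submodule.span ℝ ((fun r i => (A r i : ℝ)) '' {r | ∑ i, (A r i : ℝ) * x i = b r}) = ⊤ := by
  classical
  by_contra hne
  obtain ⟨f, hf0, hf⟩ := Submodule.exists_le_ker_of_lt_top _ (lt_top_iff_ne_top.2 hne)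
  set v : ι → ℝ := fun i => f (Pi.single i 1) with hv
  have hfv : ∀ y, f y = ∑ i, y i * v i := by
    intro y
    conv_lhs => rw [← Finset.univ_sum_single y]
    rw [map_sum]
    refine Finset.sum_congr rfl fun i _ => ?_
    have : (Pi.single i (y i) : ι → ℝ) = y i • Pi.single i (1 : ℝ) := by
      rw [← Pi.single_smul, smul_eq_mul, mul_one]
    rw [this, map_smul, smul_eq_mul]
  have hv0 : v ≠ 0 := by
    intro h
    apply hf0
    refine LinearMap.ext fun y => ?_
    simp [hfv, h]
  have htight : ∀ r, ∑ i, (A r i : ℝ) * x i = b r → ∑ i, (A r i : ℝ) * v i = 0 := by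
    intro r hr
    rw [← hfv]
    exact hf (Submodule.subset_span ⟨r, hr, rfl⟩)
  have hlin : ∀ (r : κ) (s : ℝ), ∑ i, (A r i : ℝ) * (x + s • v) i
      = ∑ i, (A r i : ℝ) * x i + s * ∑ i, (A r i : ℝ) * v i := by
    intro r s
    simp only [Finset.mul_sum, ← Finset.sum_add_distrib]
    refine Finset.sum_congr rfl fun i _ => ?_
    simp only [Pi.add_apply, Pi.smul_apply, smul_eq_mul]
    ring
  have hev : ∀ᶠ s : ℝ in nhds 0, ∀ r, ∑ i, (A r i : ℝ) * (x + s • v) i ≤ b r := by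
    rw [Filter.eventually_all]
    intro r
    rcases (hx.1 r).eq_or_lt with h | h
    · exact Filter.Eventually.of_forall fun s => by rw [hlin, htight r h, mul_zero, add_zero, h]
    · have hc : Continuous fun s : ℝ => ∑ i, (A r i : ℝ) * (x + s • v) i := by fun_prop
      have h0 : ∑ i, (A r i : ℝ) * (x + (0 : ℝ) • v) i < b r := by simpa using h
      exact (hc.continuousAt.eventually_lt continuousAt_const h0).mono fun s hs => hs.le
  obtain ⟨δ, hδ, hball⟩ := Metric.eventually_nhds_iff.1 hev
  have h1 : x + (δ / 2) • v ∈ integralPolyhedron A b := fun r => hball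
    (by rw [Real.dist_eq, sub_zero, abs_of_pos (by positivity)]; linarith) r
  have h2 : x + (-(δ / 2)) • v ∈ integralPolyhedron A b := fun r => hball
    (by rw [Real.dist_eq, sub_zero, abs_neg, abs_of_pos (by positivity)]; linarith) r
  have h3 := hx.2 h1 h2 ⟨1 / 2, 1 / 2, by norm_num, by norm_num, by norm_num, by module⟩
  have h4 : (δ / 2) • v = 0 := by simpa using h3
  exact hv0 ((smul_eq_zero.1 h4).resolve_left (by positivity))

/-- By Cramer's rule the coordinates of a vertex have a common denominator, the determinant of a
nonsingular system of tight constraints; for coefficients in `{-1, 0, 1}` it is at most `d!` in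
dimension `d`. -/
theorem exists_common_denominator [Finite κ] {A : κ → ι → ℤ} {b : κ → ℤ} {x : ι → ℝ}
    (hA : ∀ r i, |A r i| ≤ 1) (hx : x ∈ (integralPolyhedron A b).extremePoints ℝ) :
    ∃ D : ℕ, 0 < D ∧ D ≤ (Fintype.card ι).factorial ∧ ∀ i, ∃ z : ℤ, (D : ℝ) * x i = z := by
  classical
  obtain ⟨g, hg, -, hli⟩ := Submodule.exists_fun_fin_finrank_span_eq ℝ
    ((fun r i => (A r i : ℝ)) '' {r | ∑ i, (A r i : ℝ) * x i = b r})
  choose row htight hrow using hg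
  have hcard : Fintype.card ι = Module.finrank ℝ (Submodule.span ℝ
      ((fun r i => (A r i : ℝ)) '' {r | ∑ i, (A r i : ℝ) * x i = b r})) := by
    rw [span_tight_eq_top hx, finrank_top, Module.finrank_fintype_fun_eq_card]
  let e := Fintype.equivFinOfCardEq hcard
  let B : Matrix ι ι ℤ := Matrix.of fun i j => A (row (e i)) j
  have hdet : B.det ≠ 0 := by
    have h1 : LinearIndependent ℝ (B.map (Int.cast : ℤ → ℝ)).row := by
      have h2 := hli.comp e e.injective
      have h3 : (B.map (Int.cast : ℤ → ℝ)).row = g ∘ e := by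
        funext i
        rw [Function.comp_apply, ← hrow]
        rfl
      rwa [h3]
    have h4 := (Matrix.isUnit_iff_isUnit_det _).1 (Matrix.linearIndependent_rows_iff_isUnit.1 h1)
    have h5 : (B.map (Int.cast : ℤ → ℝ)).det = (B.det : ℝ) := (Int.cast_det B).symm
    rw [h5] at h4
    exact_mod_cast h4.ne_zero
  refine ⟨B.det.natAbs, Int.natAbs_pos.2 hdet, ?_, ?_⟩
  · have h := Matrix.det_le (A := B) (abv := AbsoluteValue.abs) (x := 1) fun i j => hA _ _
    rw [one_pow, nsmul_eq_mul, mul_one, AbsoluteValue.abs_apply] at h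
    zify
    exact h
  · have hBx : (B.map (Int.cast : ℤ → ℝ)).mulVec x = fun i => (b (row (e i)) : ℝ) := by
      funext i
      exact htight (e i)
    have hadj : ∀ i, (B.det : ℝ) * x i = ((B.adjugate.mulVec fun i => b (row (e i))) i : ℤ) := by
      intro i
      have h6 : (B.map (Int.cast : ℤ → ℝ)).adjugate.mulVec
          ((B.map (Int.cast : ℤ → ℝ)).mulVec x) i = (B.det : ℝ) * x i := by
        rw [Matrix.mulVec_mulVec, Matrix.adjugate_mul, Matrix.smul_mulVec, Matrix.one_mulVec,
          ← Int.cast_det]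
        rfl
      have h7 : (B.map (Int.cast : ℤ → ℝ)).adjugate = B.adjugate.map (Int.cast : ℤ → ℝ) :=
        ((Int.castRingHom ℝ).map_adjugate B).symm
      rw [← h6, hBx, h7]
      simp [Matrix.mulVec, dotProduct]
    intro i
    rw [Nat.cast_natAbs]
    rcases abs_choice B.det with h | h
    · exact ⟨_, by rw [h, hadj i]⟩
    · exact ⟨-(B.adjugate.mulVec fun i => b (row (e i))) i, by
        rw [h, Int.cast_neg, Int.cast_neg, neg_mul, hadj i]⟩

/-- A common denominator for all vertices of all polyhedra of dimension at most `d` that are given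
by integer right-hand sides and coefficients in `{-1, 0, 1}`. -/
def vertexScale (d : ℕ) : ℕ := d.factorial.factorial

theorem vertexScale_pos (d : ℕ) : 0 < vertexScale d := Nat.factorial_pos _

theorem vertexScale_mul_integral [Finite κ] {A : κ → ι → ℤ} {b : κ → ℤ} {x : ι → ℝ} {d : ℕ}
    (hd : Fintype.card ι ≤ d) (hA : ∀ r i, |A r i| ≤ 1)
    (hx : x ∈ (integralPolyhedron A b).extremePoints ℝ) (i : ι) :
    ∃ z : ℤ, (vertexScale d : ℝ) * x i = z := by
  obtain ⟨D, hD, hle, h⟩ := exists_common_denominator hA hx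
  obtain ⟨w, hw⟩ := Nat.dvd_factorial hD (hle.trans (Nat.factorial_le hd))
  obtain ⟨z, hz⟩ := h i
  refine ⟨w * z, ?_⟩
  rw [vertexScale, hw]
  push_cast
  rw [← hz]
  ring

/-- A compact polyhedron has only finitely many vertices, since they lie in a bounded part of a
lattice. -/
theorem finite_extremePoints [Finite κ] {A : κ → ι → ℤ} {b : κ → ℤ}
    (hA : ∀ r i, |A r i| ≤ 1) (hc : IsCompact (integralPolyhedron A b)) :
    ((integralPolyhedron A b).extremePoints ℝ).Finite := by
  obtain ⟨M, hM⟩ := hc.isBounded.exists_norm_le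
  set q := vertexScale (Fintype.card ι)
  have hq : (0 : ℝ) < q := by exact_mod_cast vertexScale_pos _
  obtain ⟨L, hL⟩ := exists_nat_ge ((q : ℝ) * M)
  have hfin : (Set.pi Set.univ fun _ : ι => Set.Icc (-(L : ℤ)) L).Finite :=
    Set.Finite.pi fun _ => Set.finite_Icc _ _
  refine (hfin.image fun z i => (z i : ℝ) / q).subset fun x hx => ?_
  choose z hz using vertexScale_mul_integral le_rfl hA hx
  refine ⟨z, fun i _ => ?_, ?_⟩
  · have h1 : |x i| ≤ M := (norm_le_pi_norm x i).trans (hM x hx.1)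
    have h2 : |(z i : ℝ)| ≤ L := by
      rw [← hz, abs_mul, abs_of_pos hq]
      exact (mul_le_mul_of_nonneg_left h1 hq.le).trans hL
    rw [Set.mem_Icc, ← abs_le]
    exact_mod_cast h2
  · funext i
    change (z i : ℝ) / q = x i
    rw [← hz i, mul_div_cancel_left₀ _ hq.ne']

end Polyhedra

/-- A compact convex set with finitely many extreme points is their convex hull. -/
theorem convexHull_extremePoints_of_finite {ι : Type*} [Fintype ι] {K : Set (ι → ℝ)}
    (hc : IsCompact K) (hK : Convex ℝ K) (hf : (K.extremePoints ℝ).Finite) :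
    convexHull ℝ (K.extremePoints ℝ) = K := by
  rw [← (hf.isClosed_convexHull ℝ).closure_eq,
    closure_convexHull_extremePoints hc hK]

namespace CapacitatedNetwork

variable {ν ε μ 𝒜 : Type*} (N : CapacitatedNetwork ν ε μ 𝒜)

/-! ### Steiner trees inside edge sets -/

variable {N} in
theorem Reach.cases_edge {E : Set ε} {x y : ν} (h : N.Reach E x y) :
    x = y ∨ ∃ e ∈ E, N.tgt e = y ∧ N.Reach E x (N.src e) := by
  rcases Relation.ReflTransGen.cases_tail h with h | ⟨z, hz, e, he, rfl, rfl⟩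
  · exact Or.inl h.symm
  · exact Or.inr ⟨e, he, rfl, hz⟩

theorem wellFounded_nodes [Finite ν] :
    WellFounded (fun y z : ν => ∃ e, N.src e = y ∧ N.tgt e = z) := by
  have : Std.Irrefl (Relation.TransGen fun y z : ν => ∃ e, N.src e = y ∧ N.tgt e = z) :=
    ⟨N.acyclic⟩
  have h : WellFounded (Relation.TransGen fun y z : ν => ∃ e, N.src e = y ∧ N.tgt e = z) :=
    Finite.wellFounded_of_trans_of_irrefl _
  exact h.mono fun _ _ hab => Relation.TransGen.single hab

/-- If every node of `Z` can be reached from `s` inside `G`, then `G` contains a Steiner tree: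
choose for each reachable node other than `s` one edge of `G` entering it from a reachable node.
By acyclicity, following the chosen edges backwards leads to `s`. -/
theorem exists_isSteinerTree_subset [Finite ν] [Finite ε] {s : ν} {Z : Set ν} {G : Set ε}
    (hZ : ∀ z ∈ Z, N.Reach G s z) : ∃ T : Finset ε, (T : Set ε) ⊆ G ∧ N.IsSteinerTree s Z T := by
  have hpar : ∀ x : {x // N.Reach G s x ∧ x ≠ s},
      ∃ e ∈ G, N.tgt e = x ∧ N.Reach G s (N.src e) := fun x =>
    x.2.1.cases_edge.resolve_left fun h => x.2.2 h.symm
  choose par hparG hpart hparr using hpar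
  set T : Finset ε := (Set.toFinite (Set.range par)).toFinset
  have hT : (T : Set ε) = Set.range par := Set.Finite.coe_toFinset _
  have hmem : ∀ e, e ∈ T ↔ ∃ x, par x = e := fun e => by
    rw [← Finset.mem_coe, hT, Set.mem_range]
  have hreach : ∀ x, N.Reach G s x → N.Reach (T : Set ε) s x := by
    intro x
    induction x using N.wellFounded_nodes.induction with
    | _ x ih =>
      intro hx
      by_cases hxs : x = s
      · rw [hxs]
        exact Relation.ReflTransGen.refl
      · have h1 := ih _ ⟨par ⟨x, hx, hxs⟩, rfl, hpart _⟩ (hparr _)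
        exact h1.tail ⟨par ⟨x, hx, hxs⟩, (hmem _).2 ⟨_, rfl⟩, rfl, hpart _⟩
  refine ⟨T, ?_, ?_, ?_, ?_, fun z hz => hreach z (hZ z hz)⟩
  · rw [hT]
    rintro _ ⟨x, rfl⟩
    exact hparG x
  · intro e he
    obtain ⟨x, rfl⟩ := (hmem e).1 he
    rw [hpart]
    exact x.2.2
  · intro e he e' he' h
    obtain ⟨x, rfl⟩ := (hmem e).1 he
    obtain ⟨x', rfl⟩ := (hmem e').1 he'
    rw [hpart, hpart] at h
    rw [Subtype.ext h]
  · intro e he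
    obtain ⟨x, rfl⟩ := (hmem e).1 he
    exact hreach _ (hparr x)

/-- If each edge of `G` starts at `s` or continues another edge of `G`, then all end nodes of edges
of `G` can be reached from `s` inside `G`. -/
theorem reach_tgt_of_continues [Finite ε] {s : ν} {G : Set ε}
    (hG : ∀ e ∈ G, N.src e = s ∨ ∃ e' ∈ G, N.tgt e' = N.src e) :
    ∀ e ∈ G, N.Reach G s (N.tgt e) := by
  intro e
  induction e using N.wellFounded_feeds.induction with
  | _ e ih =>
    intro he
    rcases hG e he with h | ⟨e', he', h⟩
    · exact Relation.ReflTransGen.single ⟨e, he, h, rfl⟩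
    · have h1 := ih e' h he'
      rw [h] at h1
      exact h1.tail ⟨e, he, rfl, rfl⟩

variable {N} in
/-- The edge set carrying one message coordinate contains a Steiner tree: its edges continue each
other back to the node generating the message, and it enters each node demanding the message. -/
theorem IsMultipleMulticast.exists_steinerTree_subset [Finite ν] [Finite ε]
    (hN : N.IsMultipleMulticast) {m : μ} {G : Set ε}
    (hsrc : ∀ e ∈ G, m ∈ N.S (N.src e) ∨ ∃ e' ∈ G, N.tgt e' = N.src e)
    (hdem : ∀ x, m ∈ N.R x → m ∈ N.S x ∨ ∃ e ∈ G, N.tgt e = x) :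
    ∃ T : N.SteinerTree m, (T.1 : Set ε) ⊆ G := by
  obtain ⟨s, hs, huniq⟩ := (hN m).1
  have hreach := N.reach_tgt_of_continues (s := s) (G := G) fun e he =>
    (hsrc e he).imp_left (huniq _)
  obtain ⟨T, hTG, hT⟩ := N.exists_isSteinerTree_subset (s := s) (Z := {x | m ∈ N.R x}) (G := G)
    fun x hx => by
      rcases hdem x hx with h | ⟨e, he, rfl⟩
      · rw [huniq x h]
        exact Relation.ReflTransGen.refl
      · exact hreach e he
  exact ⟨⟨T, s, hs, hT⟩, hTG⟩

theorem nonempty_steinerTree [Finite ν] [Finite ε] (hN : N.Nondegenerate)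
    (hM : N.IsMultipleMulticast) (m : μ) : Nonempty (N.SteinerTree m) := by
  obtain ⟨s, hs, huniq⟩ := (hM m).1
  obtain ⟨T, -, hT⟩ := N.exists_isSteinerTree_subset (s := s) (Z := {x | m ∈ N.R x})
    (G := Set.univ) fun x hx => by
      obtain ⟨y, hy, h⟩ := hN.1 x m hx
      rwa [← huniq y hy]
  exact ⟨⟨T, s, hs, hT⟩⟩

variable {N} in
/-- A Steiner tree has an edge, because a demanding node differs from the root. -/
theorem SteinerTree.exists_mem (hN : N.Nondegenerate) (hM : N.IsMultipleMulticast) {m : μ}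
    (T : N.SteinerTree m) : ∃ e, e ∈ T.1 := by
  obtain ⟨T, s, hs, hT⟩ := T
  obtain ⟨z, hz⟩ := (hM m).2
  rcases (hT.2.2.2 z hz).cases_edge with h | ⟨e, he, -⟩
  · exact absurd hz (h ▸ hN.2 s m hs)
  · exact ⟨e, he⟩

/-! ### Routing codes from Steiner-tree packings -/

section TreeCode

variable {N} {F : Type} [Field F] {k : μ → ℕ} {n : ℕ}
  (τ : ∀ m, Fin (k m) → N.SteinerTree m) (slot : ∀ e : ε, (Σ m, Fin (k m)) → Fin (n * N.c e))

open Classical in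
/-- Read the message coordinate `l` at the node `x`: directly if `x` generates the message,
otherwise from the slot of an in-edge of `x` in the tree assigned to `l`. -/
noncomputable def readCoordinate (x : ν) (l : Σ m, Fin (k m)) (inp : N.NodeInput F k n x) : F :=
  if h : l.1 ∈ N.S x then inp.1 ⟨l.1, h⟩ l.2
  else if h : ∃ e, N.tgt e = x ∧ e ∈ (τ l.1 l.2).1 then inp.2 ⟨h.choose, h.choose_spec.1⟩ (slot _ l)
  else 0

theorem readCoordinate_copies (x : ν) (l : Σ m, Fin (k m)) :
    (∃ m j, ∀ inp : N.NodeInput F k n x, readCoordinate τ slot x l inp = inp.1 m j) ∨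
      (∃ e i, ∀ inp : N.NodeInput F k n x, readCoordinate τ slot x l inp = inp.2 e i) ∨
        ∀ inp : N.NodeInput F k n x, readCoordinate τ slot x l inp = 0 := by
  by_cases h : l.1 ∈ N.S x
  · exact Or.inl ⟨⟨l.1, h⟩, l.2, fun inp => dif_pos h⟩
  by_cases h' : ∃ e, N.tgt e = x ∧ e ∈ (τ l.1 l.2).1
  · exact Or.inr (Or.inl ⟨⟨h'.choose, h'.choose_spec.1⟩, slot _ l, fun inp => by
      rw [readCoordinate, dif_neg h, dif_pos h']⟩)
  · exact Or.inr (Or.inr fun inp => by rw [readCoordinate, dif_neg h, dif_neg h'])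

variable {τ slot} in
theorem readCoordinate_eq {x : ν} {l : Σ m, Fin (k m)} {inp : N.NodeInput F k n x}
    {a : ∀ m, Fin (k m) → F} (hmsg : ∀ m, inp.1 m = a m)
    (hedge : ∀ e, e.1 ∈ (τ l.1 l.2).1 → inp.2 e (slot e.1 l) = a l.1 l.2) {s : ν}
    (hs : l.1 ∈ N.S s) (hx : N.Reach (τ l.1 l.2).1 s x) :
    readCoordinate τ slot x l inp = a l.1 l.2 := by
  by_cases h : l.1 ∈ N.S x
  · rw [readCoordinate, dif_pos h, hmsg]
  · have h' : ∃ e, N.tgt e = x ∧ e ∈ (τ l.1 l.2).1 := by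
      rcases hx.cases_edge with rfl | ⟨e, he, h1, -⟩
      · exact absurd hs h
      · exact ⟨e, h1, he⟩
    rw [readCoordinate, dif_neg h, dif_pos h']
    exact hedge ⟨h'.choose, h'.choose_spec.1⟩ h'.choose_spec.2

open Classical in
/-- The routing code that sends each message coordinate `l` along its tree, through the coordinate
`slot e l` of each edge `e` of the tree. It works if these coordinates differ for different `l`. -/
noncomputable def treeCode [Finite F] (hF : Nat.card 𝒜 ≤ Nat.card F) (hk : ∀ m, 0 < k m)
    (hn : 0 < n) : N.FractionalCode F k n where
  alphabet_le := hF
  k_pos := hk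
  n_pos := hn
  edgeFn e inp t :=
    if h : ∃ l : Σ m, Fin (k m), e ∈ (τ l.1 l.2).1 ∧ slot e l = t then
      readCoordinate τ slot (N.src e) h.choose inp
    else 0
  decFn x m _ inp j := readCoordinate τ slot x ⟨m, j⟩ inp

variable {τ slot} in
theorem exists_routingSolution_of_trees [Finite ε] [Finite F] (hF : Nat.card 𝒜 ≤ Nat.card F)
    (hk : ∀ m, 0 < k m) (hn : 0 < n)
    (hslot : ∀ e, Set.InjOn (slot e) {l | e ∈ (τ l.1 l.2).1}) :
    ∃ D : N.FractionalCode F k n, D.IsRouting ∧ D.IsSolution ∧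
      D.active ⊆ {p | ∃ l : Σ m, Fin (k m), p.1 ∈ (τ l.1 l.2).1 ∧ slot p.1 l = p.2} := by
  set D := treeCode τ slot hF hk hn with hD
  have hcarry : ∀ (a : ∀ m, Fin (k m) → F) (l : Σ m, Fin (k m)) (e : ε),
      e ∈ (τ l.1 l.2).1 → D.symbol a e (slot e l) = a l.1 l.2 := by
    intro a l e
    induction e using N.wellFounded_feeds.induction with
    | _ e ih =>
      intro he
      have h : ∃ l' : Σ m, Fin (k m), e ∈ (τ l'.1 l'.2).1 ∧ slot e l' = slot e l := ⟨l, he, rfl⟩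
      have hl : h.choose = l := hslot e h.choose_spec.1 he h.choose_spec.2
      obtain ⟨s, hs, hT⟩ := (τ l.1 l.2).2
      rw [D.symbol_eq]
      refine (dif_pos h).trans ?_
      rw [hl]
      exact readCoordinate_eq (fun _ => rfl) (fun e' he' => ih e'.1 e'.2 he') hs (hT.2.2.1 e he)
  refine ⟨D, ⟨fun e t => ?_, fun x m hm j => readCoordinate_copies τ slot x ⟨m, j⟩⟩, ?_, ?_⟩
  · by_cases h : ∃ l : Σ m, Fin (k m), e ∈ (τ l.1 l.2).1 ∧ slot e l = t
    · have h1 : ∀ inp, D.edgeFn e inp t = readCoordinate τ slot (N.src e) h.choose inp :=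
        fun inp => dif_pos h
      simp only [h1]
      exact readCoordinate_copies τ slot _ _
    · exact Or.inr (Or.inr fun inp => dif_neg h)
  · intro a x m hm
    funext j
    obtain ⟨s, hs, hT⟩ := (τ m j).2
    exact readCoordinate_eq (l := ⟨m, j⟩) (fun _ => rfl) (fun e he => hcarry a ⟨m, j⟩ e.1 he) hs
      (hT.2.2.2 x hm)
  · rintro ⟨e, t⟩ ⟨a, b, hab⟩
    by_contra h
    refine hab ?_
    change D.symbol a e t = D.symbol b e t
    have h0 : ∀ c : ∀ m, Fin (k m) → F, D.symbol c e t = 0 := fun c => by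
      rw [D.symbol_eq]
      exact dif_neg h
    rw [h0, h0]

end TreeCode

/-! ### Steiner trees from routing solutions -/

namespace FractionalCode

variable {N} {F : Type} [Field F] {k : μ → ℕ} {n : ℕ}

theorem label_eq_of_forall {m m' : μ} {j : Fin (k m)} {j' : Fin (k m')}
    (h : ∀ a : ∀ m, Fin (k m) → F, a m j = a m' j') :
    (⟨m, j⟩ : Σ m, Fin (k m)) = ⟨m', j'⟩ := by
  classical
  by_contra hne
  have h1 := h fun m'' j'' => if (⟨m'', j''⟩ : Σ m, Fin (k m)) = ⟨m, j⟩ then 1 else 0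
  rw [if_pos rfl, if_neg (Ne.symm hne)] at h1
  exact one_ne_zero h1

theorem not_forall_eq_zero {m : μ} {j : Fin (k m)} :
    ¬ ∀ a : ∀ m, Fin (k m) → F, a m j = 0 :=
  fun h => one_ne_zero (h fun _ _ => 1)

variable [Finite F] {C : N.FractionalCode F k n}

theorem Carries.mem_active [Finite ε] {e : ε} {t : Fin (n * N.c e)} {m : μ} {j : Fin (k m)}
    (h : C.Carries e t m j) : (⟨e, t⟩ : Σ e, Fin (n * N.c e)) ∈ C.active := by
  refine ⟨fun _ _ => 1, fun _ _ => 0, ?_⟩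
  rw [h, h]
  exact one_ne_zero

/-- A copying map that outputs the `j`-th coordinate of `m` copies it from the message, if it is
generated at the node, or from a coordinate of an in-edge that carries it. -/
theorem exists_carries_of_copies [Finite ε] {x : ν} {d : ℕ} {g : N.NodeInput F k n x → Fin d → F}
    (hg : N.CopiesComponents g) {t : Fin d} {m : μ} {j : Fin (k m)}
    (h : ∀ a, g (fun m => a m, fun e => C.symbol a e) t = a m j) :
    m ∈ N.S x ∨ ∃ e, (∃ t', C.Carries e t' m j) ∧ N.tgt e = x := by
  rcases hg t with ⟨m', j', h1⟩ | ⟨e, i, h1⟩ | h1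
  · have h2 := label_eq_of_forall (F := F) (m := m) (m' := m') (j := j) (j' := j') fun a => by
      rw [← h a, h1]
    left
    rw [(Sigma.mk.inj_iff.1 h2).1]
    exact m'.2
  · exact Or.inr ⟨e, ⟨i, fun a => by rw [← h a, h1]⟩, e.2⟩
  · exact absurd (fun a => by rw [← h a, h1]) (not_forall_eq_zero (F := F) (m := m) (j := j))

/-- In a routing solution the edges carrying a given message coordinate contain a Steiner tree. -/
theorem exists_trees_of_isSolution [Finite ν] [Finite ε] (hM : N.IsMultipleMulticast)
    (hR : C.IsRouting) (hC : C.IsSolution) :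
    ∃ τ : ∀ m, Fin (k m) → N.SteinerTree m,
      ∀ m j e, e ∈ (τ m j).1 → ∃ t, C.Carries e t m j := by
  have h : ∀ m (j : Fin (k m)), ∃ T : N.SteinerTree m,
      (T.1 : Set ε) ⊆ {e | ∃ t, C.Carries e t m j} := by
    intro m j
    refine hM.exists_steinerTree_subset ?_ ?_
    · rintro e ⟨t, ht⟩
      exact exists_carries_of_copies (hR.1 e) (t := t) fun a => by
        rw [← ht a, C.symbol_eq a e]
    · intro x hx
      exact exists_carries_of_copies (hR.2 x m hx) (t := j) fun a => by
        rw [hC a x m hx]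
  choose τ hτ using h
  exact ⟨τ, fun m j e he => hτ m j he⟩

open Classical in
/-- Different message coordinates are carried by different coordinates of an edge. -/
theorem exists_injOn_slots [Finite ε] {τ : ∀ m, Fin (k m) → N.SteinerTree m}
    (hτ : ∀ m j e, e ∈ (τ m j).1 → ∃ t, C.Carries e t m j) :
    ∃ slot : ∀ e : ε, (Σ m, Fin (k m)) → Fin (n * N.c e),
      (∀ e m j, e ∈ (τ m j).1 → C.Carries e (slot e ⟨m, j⟩) m j) ∧
        ∀ e, Set.InjOn (slot e) {l | e ∈ (τ l.1 l.2).1} := by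
  let slot : ∀ e : ε, (Σ m, Fin (k m)) → Fin (n * N.c e) := fun e l =>
    if h : ∃ t, C.Carries e t l.1 l.2 then h.choose
    else ⟨0, Nat.mul_pos C.n_pos (N.c e).pos⟩
  have hslot : ∀ e m j, e ∈ (τ m j).1 → C.Carries e (slot e ⟨m, j⟩) m j := by
    intro e m j he
    have h : ∃ t, C.Carries e t m j := hτ m j e he
    have h1 : slot e ⟨m, j⟩ = h.choose := dif_pos h
    rw [h1]
    exact h.choose_spec
  refine ⟨slot, hslot, ?_⟩
  rintro e ⟨m, j⟩ hl ⟨m', j'⟩ hl' heq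
  have h1 := hslot e m j hl
  rw [heq] at h1
  exact label_eq_of_forall fun a => by rw [← h1 a, hslot e m' j' hl' a]

/-- A minimal routing solution uses exactly one coordinate for each message coordinate and each edge
of its tree, and nothing else: dropping everything but one such coordinate leaves a solution. -/
theorem IsMinimalRoutingSolution.exists_trees [Finite ν] [Finite ε] (hM : N.IsMultipleMulticast)
    (hC : C.IsMinimalRoutingSolution) :
    ∃ τ : ∀ m, Fin (k m) → N.SteinerTree m,
      (∀ e m j, e ∈ (τ m j).1 → ∃! t, C.Carries e t m j) ∧
        ∀ e t, (⟨e, t⟩ : Σ e, Fin (n * N.c e)) ∈ C.active →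
          ∃ m j, e ∈ (τ m j).1 ∧ C.Carries e t m j := by
  obtain ⟨τ, hτ⟩ := exists_trees_of_isSolution hM hC.1 hC.2.1
  obtain ⟨slot, hslot, hinj⟩ := exists_injOn_slots hτ
  obtain ⟨D, hDR, hDS, hD⟩ :=
    exists_routingSolution_of_trees C.alphabet_le C.k_pos C.n_pos hinj
  have hsub : D.active ⊆ C.active := by
    rintro ⟨e, t⟩ hp
    obtain ⟨⟨m, j⟩, h1, h2⟩ := hD hp
    change slot e ⟨m, j⟩ = t at h2
    rw [← h2]
    exact (hslot e m j h1).mem_active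
  have heq : D.active = C.active := by
    by_contra hne
    exact hC.2.2 F _ _ D hDR hDS (hsub.ssubset_of_ne hne)
  have hact : ∀ e t, (⟨e, t⟩ : Σ e, Fin (n * N.c e)) ∈ C.active →
      ∃ m j, e ∈ (τ m j).1 ∧ slot e ⟨m, j⟩ = t := by
    intro e t h
    rw [← heq] at h
    obtain ⟨⟨m, j⟩, h1, h2⟩ := hD h
    exact ⟨m, j, h1, h2⟩
  refine ⟨τ, fun e m j he => ⟨slot e ⟨m, j⟩, hslot e m j he, fun t ht => ?_⟩, fun e t h => ?_⟩
  · obtain ⟨m', j', h1, h2⟩ := hact e t ht.mem_active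
    rw [← h2]
    congr 1
    refine label_eq_of_forall (F := F) fun a => ?_
    rw [← ht a, ← h2, hslot e m' j' h1 a]
  · obtain ⟨m, j, h1, h2⟩ := hact e t h
    exact ⟨m, j, h1, h2 ▸ hslot e m j h1⟩

end FractionalCode

/-! ### The packing constraints -/

open Classical in
/-- Constraint matrix of the packing polytope: capacity constraints of the edges and sign
constraints of the trees. -/
noncomputable def packingMatrix : ε ⊕ N.AllSteinerTrees → N.AllSteinerTrees → ℤ
  | .inl e, T => if e ∈ T.2.1 then 1 else 0
  | .inr T', T => if T = T' then -1 else 0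

/-- Right-hand side of the packing constraints when all capacities are multiplied by `n`. -/
def packingBound (n : ℕ) : ε ⊕ N.AllSteinerTrees → ℤ
  | .inl e => n * (N.c e : ℕ)
  | .inr _ => 0

theorem abs_packingMatrix_le (r : ε ⊕ N.AllSteinerTrees) (T : N.AllSteinerTrees) :
    |N.packingMatrix r T| ≤ 1 := by
  rcases r with e | T'
  · simp only [packingMatrix]
    split_ifs <;> simp
  · simp only [packingMatrix]
    split_ifs <;> simp

/-! ### Integral packings of Steiner trees -/

section

variable {N} {k : μ → ℕ} {n : ℕ} [Fintype μ]

open Classical in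
theorem card_filter_le_of_injOn {τ : ∀ m, Fin (k m) → N.SteinerTree m} {e : ε}
    {slot : (Σ m, Fin (k m)) → Fin (n * N.c e)}
    (h : Set.InjOn slot {l | e ∈ (τ l.1 l.2).1}) :
    (Finset.univ.filter fun l : Σ m, Fin (k m) => e ∈ (τ l.1 l.2).1).card ≤ n * N.c e := by
  rw [← Fintype.card_fin (n * N.c e), ← Finset.card_univ]
  exact Finset.card_le_card_of_injOn slot (fun _ _ => Finset.mem_coe.2 (Finset.mem_univ _))
    (by simpa using h)

end

section Packing

variable [Finite ε]

open Classical in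
/-- With `n` symbols per unit of capacity, `k m` symbols of each message `m` can be sent along
Steiner trees: `x T` symbols along the tree `T`. -/
def HasTreePacking [Fintype μ] (n : ℕ) (k : μ → ℕ) : Prop :=
  ∃ x : N.AllSteinerTrees → ℕ,
    (∀ e, ∑ T, (if e ∈ T.2.1 then 1 else 0) * x T ≤ n * N.c e) ∧
      ∀ m, ∑ T : N.SteinerTree m, x ⟨m, T⟩ = k m

variable {N} {k : μ → ℕ} {n : ℕ}

open Classical in
theorem sum_card_fiber (τ : ∀ m, Fin (k m) → N.SteinerTree m) (m : μ) :
    ∑ T : N.SteinerTree m, (Finset.univ.filter fun j => τ m j = T).card = k m := by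
  rw [← Finset.card_eq_sum_card_fiberwise fun _ _ => Finset.mem_coe.2 (Finset.mem_univ _)]
  simp

open Classical in
theorem usagePerMessage_treeUsage (τ : ∀ m, Fin (k m) → N.SteinerTree m) :
    N.usagePerMessage (treeUsage n τ) = fun m => (k m : ℝ) / n := by
  funext m
  change ∑ T : N.SteinerTree m, treeUsage n τ ⟨m, T⟩ = _
  simp only [treeUsage, ← Finset.sum_div]
  have h := sum_card_fiber τ m
  congr 1
  exact_mod_cast h

variable [Fintype μ]

open Classical in
theorem sum_mul_card_fiber (τ : ∀ m, Fin (k m) → N.SteinerTree m) (e : ε) :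
    ∑ T : N.AllSteinerTrees, (if e ∈ T.2.1 then 1 else 0) *
        (Finset.univ.filter fun j => τ T.1 j = T.2).card =
      (Finset.univ.filter fun l : Σ m, Fin (k m) => e ∈ (τ l.1 l.2).1).card := by
  rw [Finset.card_filter, Fintype.sum_sigma, Fintype.sum_sigma]
  refine Finset.sum_congr rfl fun m _ => ?_
  rw [← Finset.sum_fiberwise Finset.univ (τ m)]
  refine Finset.sum_congr rfl fun T _ => ?_
  have h : ∀ j ∈ Finset.univ.filter fun j => τ m j = T,
      (if e ∈ (τ m j).1 then 1 else 0) = if e ∈ T.1 then 1 else 0 := fun j hj => by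
    rw [(Finset.mem_filter.1 hj).2]
  rw [Finset.sum_congr rfl h, Finset.sum_const, smul_eq_mul, mul_comm]

open Classical in
theorem hasTreePacking_iff :
    N.HasTreePacking n k ↔ ∃ τ : ∀ m, Fin (k m) → N.SteinerTree m,
      ∀ e, (Finset.univ.filter fun l : Σ m, Fin (k m) => e ∈ (τ l.1 l.2).1).card ≤ n * N.c e := by
  constructor
  · rintro ⟨x, hx, hk⟩
    have hcard : ∀ m, Fintype.card (Σ T : N.SteinerTree m, Fin (x ⟨m, T⟩)) = k m := by
      intro m
      rw [← hk m, Fintype.card_sigma]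
      simp
    let f m := Fintype.equivFinOfCardEq (hcard m)
    let τ : ∀ m, Fin (k m) → N.SteinerTree m := fun m j => ((f m).symm j).1
    have hfib : ∀ T : N.AllSteinerTrees,
        (Finset.univ.filter fun j => τ T.1 j = T.2).card = x T := by
      rintro ⟨m, T⟩
      rw [← Fintype.card_fin (x ⟨m, T⟩), ← Finset.card_univ]
      refine (Finset.card_bij (fun i _ => f m ⟨T, i⟩) (fun i _ => ?_) (fun i _ i' _ h => ?_)
        fun j hj => ?_).symm
      · simp [τ]
      · simpa using h
      · have h1 : ((f m).symm j).1 = T := (Finset.mem_filter.1 hj).2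
        subst h1
        exact ⟨((f m).symm j).2, Finset.mem_univ _, by simp⟩
    refine ⟨τ, fun e => ?_⟩
    rw [← sum_mul_card_fiber]
    simp only [hfib]
    exact hx e
  · rintro ⟨τ, hτ⟩
    exact ⟨fun T => (Finset.univ.filter fun j => τ T.1 j = T.2).card,
      fun e => (sum_mul_card_fiber τ e).trans_le (hτ e), fun m => sum_card_fiber τ m⟩

theorem FractionalCode.hasTreePacking [Finite ν] {F : Type} [Field F] [Finite F]
    {C : N.FractionalCode F k n} (hM : N.IsMultipleMulticast) (hR : C.IsRouting)
    (hC : C.IsSolution) : N.HasTreePacking n k := by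
  obtain ⟨τ, hτ⟩ := exists_trees_of_isSolution hM hR hC
  obtain ⟨slot, -, hinj⟩ := exists_injOn_slots hτ
  exact hasTreePacking_iff.2 ⟨τ, fun e => card_filter_le_of_injOn (hinj e)⟩

theorem HasTreePacking.mem_achievableRoutingRates (h : N.HasTreePacking n k)
    (hk : ∀ m, 0 < k m) (hn : 0 < n) : (fun m => (k m : ℝ) / n) ∈ N.achievableRoutingRates := by
  classical
  obtain ⟨τ, hτ⟩ := hasTreePacking_iff.1 h
  have hslot : ∀ e, ∃ slot : (Σ m, Fin (k m)) → Fin (n * N.c e),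
      Set.InjOn slot {l | e ∈ (τ l.1 l.2).1} := by
    intro e
    have : Nonempty (Fin (n * N.c e)) := ⟨⟨0, Nat.mul_pos hn (N.c e).pos⟩⟩
    rw [Set.exists_injOn_iff_injective]
    obtain ⟨f⟩ := Function.Embedding.nonempty_of_card_le
      (α := {l : Σ m, Fin (k m) | e ∈ (τ l.1 l.2).1}) (β := Fin (n * N.c e)) (by
        rw [Fintype.card_fin]
        refine le_of_eq_of_le ?_ (hτ e)
        exact Fintype.card_subtype _)
    exact ⟨f, f.injective⟩
  choose slot hslot using hslot
  obtain ⟨p, hp, hprime⟩ := Nat.exists_infinite_primes (Nat.card 𝒜)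
  have : Fact p.Prime := ⟨hprime⟩
  obtain ⟨D, hR, hS, -⟩ := exists_routingSolution_of_trees (F := ZMod p) (by simpa using hp)
    hk hn hslot
  exact ⟨ZMod p, inferInstance, inferInstance, k, n, D, hR, hS, fun _ => rfl⟩

/-! ### The packing polytope and the capacity region -/

open Classical in
theorem treeUsage_mem_packingPolytope {τ : ∀ m, Fin (k m) → N.SteinerTree m} (hn : 0 < n)
    (hτ : ∀ e, (Finset.univ.filter fun l : Σ m, Fin (k m) => e ∈ (τ l.1 l.2).1).card
      ≤ n * N.c e) : treeUsage n τ ∈ N.packingPolytope := by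
  have hn' : (0 : ℝ) < n := by exact_mod_cast hn
  refine ⟨fun e => ?_, fun T => by unfold treeUsage; positivity⟩
  simp only [treeUsage, mul_div_assoc', ← Finset.sum_div]
  rw [div_le_iff₀ hn', mul_comm]
  have h := (sum_mul_card_fiber τ e).trans_le (hτ e)
  exact_mod_cast h

theorem HasTreePacking.exists_mem (h : N.HasTreePacking n k) (hn : 0 < n) :
    ∃ x ∈ N.packingPolytope, N.usagePerMessage x = fun m => (k m : ℝ) / n := by
  obtain ⟨τ, hτ⟩ := hasTreePacking_iff.1 h
  exact ⟨_, treeUsage_mem_packingPolytope hn hτ, usagePerMessage_treeUsage τ⟩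

variable (N)

open Classical in
theorem mem_integralPolyhedron_packing {x : N.AllSteinerTrees → ℝ} :
    x ∈ integralPolyhedron N.packingMatrix (N.packingBound n) ↔
      (∀ e, ∑ T, (if e ∈ T.2.1 then (1 : ℝ) else 0) * x T ≤ n * (N.c e : ℕ)) ∧ ∀ T, 0 ≤ x T := by
  rw [integralPolyhedron, Set.mem_ofPred_eq, Sum.forall]
  refine and_congr (forall_congr' fun e => ?_) (forall_congr' fun T => ?_)
  · simp [packingMatrix, packingBound]
  · simp [packingMatrix, packingBound]

theorem packingPolytope_eq :
    N.packingPolytope = integralPolyhedron N.packingMatrix (N.packingBound 1) := by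
  ext x
  rw [mem_integralPolyhedron_packing]
  simp [packingPolytope]

theorem smul_mem_iff (hn : 0 < n) {x : N.AllSteinerTrees → ℝ} :
    (n : ℝ) • x ∈ integralPolyhedron N.packingMatrix (N.packingBound n) ↔
      x ∈ N.packingPolytope := by
  classical
  have hn' : (0 : ℝ) < n := by exact_mod_cast hn
  rw [mem_integralPolyhedron_packing]
  simp only [Pi.smul_apply, smul_eq_mul, mul_left_comm _ (n : ℝ), ← Finset.mul_sum]
  simp only [mul_le_mul_iff_right₀ hn', mul_nonneg_iff_of_pos_left hn']
  rfl

variable {N}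

theorem isCompact_packing (hN : N.Nondegenerate) (hM : N.IsMultipleMulticast) (n : ℕ) :
    IsCompact (integralPolyhedron N.packingMatrix (N.packingBound n)) := by
  classical
  choose edge hedge using fun T : N.AllSteinerTrees => T.2.exists_mem hN hM
  refine IsCompact.of_isClosed_subset
    (isCompact_Icc (a := 0) (b := fun T => (n : ℝ) * (N.c (edge T) : ℕ)))
    (isClosed_integralPolyhedron _ _) fun x hx => ?_
  rw [mem_integralPolyhedron_packing] at hx
  refine ⟨hx.2, fun T => le_trans ?_ (hx.1 (edge T))⟩
  have h := Finset.single_le_sum (f := fun T' : N.AllSteinerTrees =>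
    (if edge T ∈ T'.2.1 then (1 : ℝ) else 0) * x T') (s := Finset.univ)
    (fun T' _ => mul_nonneg (by split_ifs <;> simp) (hx.2 T')) (Finset.mem_univ T)
  simpa [hedge T] using h

theorem isCompact_packingPolytope (hN : N.Nondegenerate) (hM : N.IsMultipleMulticast) :
    IsCompact N.packingPolytope :=
  N.packingPolytope_eq ▸ isCompact_packing hN hM 1

theorem convex_packingPolytope : Convex ℝ N.packingPolytope :=
  N.packingPolytope_eq ▸ convex_integralPolyhedron _ _

theorem isCompact_image (hN : N.Nondegenerate) (hM : N.IsMultipleMulticast) :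
    IsCompact (N.usagePerMessage '' N.packingPolytope) :=
  (isCompact_packingPolytope hN hM).image N.usagePerMessage.continuous_of_finiteDimensional

/-- Rounding down the multiples of a fractional packing gives routing solutions whose rates converge
to those of the fractional packing. -/
theorem usagePerMessage_mem_routingRegion_of_pos {x : N.AllSteinerTrees → ℝ}
    (hx : x ∈ N.packingPolytope) (hpos : ∀ m, 0 < N.usagePerMessage x m) :
    N.usagePerMessage x ∈ N.routingRegion := by
  classical
  let k : ℕ → μ → ℕ := fun n m => ∑ T : N.SteinerTree m, ⌊x ⟨m, T⟩ * n⌋₊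
  have hpack : ∀ n, N.HasTreePacking n (k n) := by
    intro n
    refine ⟨fun T => ⌊x T * n⌋₊, fun e => ?_, fun m => rfl⟩
    have h1 : ∑ T : N.AllSteinerTrees, (if e ∈ T.2.1 then (1 : ℝ) else 0) * (⌊x T * n⌋₊ : ℝ)
        ≤ n * (N.c e : ℕ) := by
      calc _ ≤ ∑ T : N.AllSteinerTrees, n * ((if e ∈ T.2.1 then (1 : ℝ) else 0) * x T) := by
            refine Finset.sum_le_sum fun T _ => ?_
            rw [mul_left_comm, mul_comm (n : ℝ)]
            exact mul_le_mul_of_nonneg_left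
              (Nat.floor_le (mul_nonneg (hx.2 T) n.cast_nonneg)) (by split_ifs <;> simp)
        _ ≤ _ := by
            rw [← Finset.mul_sum]
            exact mul_le_mul_of_nonneg_left (hx.1 e) n.cast_nonneg
    exact_mod_cast h1
  have hlim : ∀ m, Filter.Tendsto (fun n : ℕ => (k n m : ℝ) / n) Filter.atTop
      (nhds (N.usagePerMessage x m)) := by
    intro m
    have h1 : ∀ n : ℕ, (k n m : ℝ) / n
        = ∑ T : N.SteinerTree m, (⌊x ⟨m, T⟩ * n⌋₊ : ℝ) / n := by
      intro n
      rw [← Finset.sum_div]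
      simp [k]
    simp only [h1]
    exact tendsto_finsetSum _ fun T _ =>
      (tendsto_nat_floor_mul_div_atTop (hx.2 _)).comp tendsto_natCast_atTop_atTop
  refine mem_closure_of_tendsto (tendsto_pi_nhds.2 hlim) ?_
  have hev : ∀ᶠ n : ℕ in Filter.atTop, ∀ m, (0 : ℝ) < (k n m : ℝ) / n :=
    Filter.eventually_all.2 fun m => (hlim m).eventually (lt_mem_nhds (hpos m))
  filter_upwards [hev, Filter.eventually_gt_atTop 0] with n h1 h2
  refine (hpack n).mem_achievableRoutingRates (fun m => ?_) h2
  by_contra h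
  have h3 := h1 m
  rw [Nat.eq_zero_of_not_pos h] at h3
  simp at h3

theorem exists_pos_mem_packingPolytope : ∃ x ∈ N.packingPolytope, ∀ T, 0 < x T := by
  classical
  set d := Fintype.card N.AllSteinerTrees
  refine ⟨fun _ => 1 / ((d : ℝ) + 1), ⟨fun e => ?_, fun T => by positivity⟩,
    fun T => by positivity⟩
  have h1 : ∑ T : N.AllSteinerTrees, (if e ∈ T.2.1 then (1 : ℝ) else 0) * (1 / ((d : ℝ) + 1))
      ≤ ∑ T : N.AllSteinerTrees, 1 / ((d : ℝ) + 1) := by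
    refine Finset.sum_le_sum fun T _ => ?_
    split_ifs
    · rw [one_mul]
    · rw [zero_mul]
      positivity
  have h2 : ∑ T : N.AllSteinerTrees, 1 / ((d : ℝ) + 1) ≤ 1 := by
    rw [Finset.sum_const, Finset.card_univ, nsmul_eq_mul, mul_one_div, div_le_one (by positivity)]
    exact le_add_of_nonneg_right zero_le_one
  have h3 : (1 : ℝ) ≤ (N.c e : ℕ) := by exact_mod_cast (N.c e).pos
  exact h1.trans (h2.trans h3)

theorem routingRegion_eq [Finite ν] (hN : N.Nondegenerate) (hM : N.IsMultipleMulticast) :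
    N.routingRegion = N.usagePerMessage '' N.packingPolytope := by
  refine subset_antisymm (closure_minimal ?_ (isCompact_image hN hM).isClosed) ?_
  · rintro r ⟨F, _, _, k, n, C, hR, hS, hr⟩
    obtain ⟨x, hx, h⟩ := (C.hasTreePacking hM hR hS).exists_mem C.n_pos
    exact ⟨x, hx, h.trans (funext fun m => (hr m).symm)⟩
  · rintro _ ⟨x, hx, rfl⟩
    obtain ⟨y, hy, hypos⟩ := exists_pos_mem_packingPolytope (N := N)
    -- Points on the half-open segment from `x` to the strictly positive `y` have positive rates.
    have hmem : ∀ s ∈ Set.Ioo (0 : ℝ) 1,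
        N.usagePerMessage ((1 - s) • x + s • y) ∈ N.routingRegion := by
      intro s hs
      refine usagePerMessage_mem_routingRegion_of_pos
        (convex_packingPolytope hx hy (sub_nonneg.2 hs.2.le) hs.1.le (by ring)) fun m => ?_
      have := nonempty_steinerTree N hN hM m
      refine Finset.sum_pos (fun T _ => ?_) Finset.univ_nonempty
      have h1 := mul_nonneg (sub_nonneg.2 hs.2.le) (hx.2 ⟨m, T⟩)
      have h2 := mul_pos hs.1 (hypos ⟨m, T⟩)
      simp only [Pi.add_apply, Pi.smul_apply, smul_eq_mul]
      linarith
    have hcont : Continuous fun s : ℝ => N.usagePerMessage ((1 - s) • x + s • y) :=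
      N.usagePerMessage.continuous_of_finiteDimensional.comp (by fun_prop)
    have hlim := (hcont.tendsto 0).mono_left (nhdsWithin_le_nhds (s := Set.Ioi 0))
    simp only [sub_zero, one_smul, zero_smul, add_zero] at hlim
    exact isClosed_closure.mem_of_tendsto hlim
      (Filter.mem_of_superset (Ioo_mem_nhdsGT one_pos) hmem)

end Packing

end CapacitatedNetwork

theorem isRationalPolytope_of_extremePoints {ι : Type*} [Fintype ι] {K : Set (ι → ℝ)}
    (hc : IsCompact K) (hK : Convex ℝ K) (hf : (K.extremePoints ℝ).Finite)
    (hrat : ∀ x ∈ K.extremePoints ℝ, ∀ i, ∃ r : ℚ, x i = r) : IsRationalPolytope K := by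
  set φ : (ι → ℚ) → ι → ℝ := fun v i => (v i : ℝ)
  have hφ : Function.Injective φ := fun v w h => funext fun i => Rat.cast_injective (congrFun h i)
  have hfin : (φ ⁻¹' K.extremePoints ℝ).Finite := hf.preimage hφ.injOn
  refine ⟨hfin.toFinset, ?_⟩
  have himg : φ '' (φ ⁻¹' K.extremePoints ℝ) = K.extremePoints ℝ := by
    refine Set.image_preimage_eq_of_subset fun x hx => ?_
    choose r hr using hrat x hx
    exact ⟨r, (funext hr).symm⟩
  rw [Set.Finite.coe_toFinset]
  change K = convexHull ℝ (φ '' _)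
  rw [himg, convexHull_extremePoints_of_finite hc hK hf]

namespace CapacitatedNetwork

variable {ν ε μ 𝒜 : Type*} (N : CapacitatedNetwork ν ε μ 𝒜)

/-! ### Pairs of packings -/

section Pairs

variable {N}

/-- Constraint matrix for pairs of packings with prescribed sum of usages: the packing constraints
for both members, and two opposite inequalities for each message. -/
noncomputable def pairMatrix [DecidableEq μ] :
    ((ε ⊕ N.AllSteinerTrees) ⊕ (ε ⊕ N.AllSteinerTrees)) ⊕ (μ ⊕ μ) →
      N.AllSteinerTrees ⊕ N.AllSteinerTrees → ℤ
  | .inl (.inl r), .inl T => N.packingMatrix r T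
  | .inl (.inl _), .inr _ => 0
  | .inl (.inr _), .inl _ => 0
  | .inl (.inr r), .inr T => N.packingMatrix r T
  | .inr (.inl m), .inl T => if T.1 = m then 1 else 0
  | .inr (.inl m), .inr T => if T.1 = m then 1 else 0
  | .inr (.inr m), .inl T => if T.1 = m then -1 else 0
  | .inr (.inr m), .inr T => if T.1 = m then -1 else 0

variable (N) in
/-- Right-hand side for pairs of packings, with capacities multiplied by `n` and sum of usages
`u`. -/
def pairBound (n : ℕ) (u : μ → ℕ) :
    ((ε ⊕ N.AllSteinerTrees) ⊕ (ε ⊕ N.AllSteinerTrees)) ⊕ (μ ⊕ μ) → ℤ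
  | .inl (.inl r) => N.packingBound n r
  | .inl (.inr r) => N.packingBound n r
  | .inr (.inl m) => u m
  | .inr (.inr m) => -u m

theorem abs_pairMatrix_le [DecidableEq μ] (r) (T) : |N.pairMatrix r T| ≤ 1 := by
  rcases r with (r | r) | (m | m) <;> rcases T with T | T <;> simp only [pairMatrix]
  any_goals exact N.abs_packingMatrix_le _ _
  any_goals split_ifs
  all_goals simp

variable [Finite ε] [Fintype μ]

theorem sum_ite_eq_usagePerMessage [DecidableEq μ] (x : N.AllSteinerTrees → ℝ) (m : μ) :
    ∑ T : N.AllSteinerTrees, (if T.1 = m then x T else 0) = N.usagePerMessage x m := by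
  rw [Fintype.sum_sigma, Finset.sum_eq_single m]
  · simp [usagePerMessage]
  · intro m' _ h
    simp [h]
  · simp

theorem mem_pairPolyhedron [DecidableEq μ] {n : ℕ} {u : μ → ℕ}
    {z : N.AllSteinerTrees ⊕ N.AllSteinerTrees → ℝ} :
    z ∈ integralPolyhedron N.pairMatrix (N.pairBound n u) ↔
      (fun T => z (.inl T)) ∈ integralPolyhedron N.packingMatrix (N.packingBound n) ∧
      (fun T => z (.inr T)) ∈ integralPolyhedron N.packingMatrix (N.packingBound n) ∧
      ∀ m, N.usagePerMessage (fun T => z (.inl T)) m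
        + N.usagePerMessage (fun T => z (.inr T)) m = u m := by
  simp only [← sum_ite_eq_usagePerMessage]
  simp only [integralPolyhedron, Set.mem_ofPred_eq, Sum.forall, Fintype.sum_sum_type, pairMatrix,
    pairBound, Int.cast_zero, zero_mul, Finset.sum_const_zero, add_zero, zero_add, Int.cast_ite,
    Int.cast_one, Int.cast_neg, ite_mul, one_mul, neg_mul, Int.cast_natCast]
  have hneg : ∀ (f : N.AllSteinerTrees → ℝ) (m : μ),
      ∑ T : N.AllSteinerTrees, (if T.1 = m then -f T else 0)
        = -∑ T : N.AllSteinerTrees, (if T.1 = m then f T else 0) := by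
    intro f m
    rw [← Finset.sum_neg_distrib]
    exact Finset.sum_congr rfl fun T _ => by split_ifs <;> simp
  simp only [hneg]
  constructor
  · rintro ⟨⟨h1, h2⟩, h3, h4⟩
    exact ⟨h1, h2, fun m => le_antisymm (h3 m) (by linarith [h4 m])⟩
  · rintro ⟨h1, h2, h3⟩
    exact ⟨⟨h1, h2⟩, fun m => (h3 m).le, fun m => by linarith [h3 m]⟩

theorem isCompact_pairPolyhedron [DecidableEq μ] (hN : N.Nondegenerate)
    (hM : N.IsMultipleMulticast) (n : ℕ) (u : μ → ℕ) :
    IsCompact (integralPolyhedron N.pairMatrix (N.pairBound n u)) := by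
  have hK := isCompact_packing hN hM n
  obtain ⟨M, hbd⟩ := hK.isBounded.exists_norm_le
  refine IsCompact.of_isClosed_subset
    (isCompact_Icc (a := fun _ => -M) (b := fun _ => M)) (isClosed_integralPolyhedron _ _)
    fun z hz => ?_
  obtain ⟨h1, h2, -⟩ := mem_pairPolyhedron.1 hz
  have h : ∀ t, |z t| ≤ M := by
    rintro (T | T)
    · exact (norm_le_pi_norm (fun T => z (.inl T)) T).trans (hbd _ h1)
    · exact (norm_le_pi_norm (fun T => z (.inr T)) T).trans (hbd _ h2)
  exact ⟨fun t => (abs_le.1 (h t)).1, fun t => (abs_le.1 (h t)).2⟩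

end Pairs

/-! ### Vertices of the capacity region -/

section Vertices

variable [Finite ε] [Fintype μ]

/-- A vector all of whose coordinates become integers on multiplication by `q`, and which is a
packing for the capacities multiplied by `n`, is `1 / q` times an integral packing. -/
theorem exists_hasTreePacking_of_integral {n q : ℕ} {x : N.AllSteinerTrees → ℝ}
    (hx : x ∈ integralPolyhedron N.packingMatrix (N.packingBound n))
    (hint : ∀ T, ∃ z : ℤ, (q : ℝ) * x T = z) :
    ∃ k : μ → ℕ, N.HasTreePacking (q * n) k ∧ ∀ m, (k m : ℝ) = q * N.usagePerMessage x m := by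
  classical
  rw [mem_integralPolyhedron_packing] at hx
  have hnat : ∀ T, ∃ w : ℕ, (w : ℝ) = q * x T := by
    intro T
    obtain ⟨z, hz⟩ := hint T
    have h1 : (0 : ℝ) ≤ z := hz ▸ mul_nonneg q.cast_nonneg (hx.2 T)
    obtain ⟨w, rfl⟩ := Int.eq_ofNat_of_zero_le (by exact_mod_cast h1 : 0 ≤ z)
    exact ⟨w, by rw [hz]; simp⟩
  choose w hw using hnat
  refine ⟨fun m => ∑ T : N.SteinerTree m, w ⟨m, T⟩, ⟨w, fun e => ?_, fun _ => rfl⟩, fun m => ?_⟩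
  · have h1 : ∑ T : N.AllSteinerTrees, (if e ∈ T.2.1 then (1 : ℝ) else 0) * (w T : ℝ)
        ≤ q * n * (N.c e : ℕ) := by
      simp only [hw, mul_left_comm _ (q : ℝ), ← Finset.mul_sum, mul_assoc]
      exact mul_le_mul_of_nonneg_left (hx.1 e) q.cast_nonneg
    exact_mod_cast h1
  · change _ = (q : ℝ) * ∑ T : N.SteinerTree m, x ⟨m, T⟩
    push_cast
    rw [Finset.mul_sum]
    exact Finset.sum_congr rfl fun T _ => hw _

variable {N}

theorem HasTreePacking.mem_routingRegion [Finite ν] (hN : N.Nondegenerate)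
    (hM : N.IsMultipleMulticast) {n : ℕ} {k : μ → ℕ} (h : N.HasTreePacking n k) (hn : 0 < n) :
    (fun m => (k m : ℝ) / n) ∈ N.routingRegion := by
  rw [routingRegion_eq hN hM]
  exact h.exists_mem hn

theorem exists_eq_of_mem_extremePoints_packingPolytope {d : ℕ}
    (hd : Fintype.card N.AllSteinerTrees ≤ d) {x : N.AllSteinerTrees → ℝ}
    (hx : x ∈ N.packingPolytope.extremePoints ℝ) (T : N.AllSteinerTrees) :
    ∃ z : ℤ, (vertexScale d : ℝ) * x T = z := by
  rw [packingPolytope_eq] at hx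
  exact vertexScale_mul_integral hd N.abs_packingMatrix_le hx T

/-- The vertices of the capacity region are the images of vertices of the packing polytope, so they
are rate vectors of integral packings for a fixed edge dimension. -/
theorem exists_hasTreePacking_of_mem_extremePoints [Finite ν] (hN : N.Nondegenerate)
    (hM : N.IsMultipleMulticast) {d : ℕ} (hd : Fintype.card N.AllSteinerTrees ≤ d) {y : μ → ℝ}
    (hy : y ∈ N.routingRegion.extremePoints ℝ) :
    ∃ k : μ → ℕ, N.HasTreePacking (vertexScale d) k ∧
      y = fun m => (k m : ℝ) / vertexScale d := by
  rw [routingRegion_eq hN hM] at hy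
  obtain ⟨x, hx, rfl⟩ := surjOn_extremePoints_image
    N.usagePerMessage.toContinuousLinearMap.toContinuousAffineMap
    (isCompact_packingPolytope hN hM) hy
  have hq := vertexScale_pos d
  have hx1 := hx.1
  rw [packingPolytope_eq] at hx1
  obtain ⟨k, hk, hkx⟩ := N.exists_hasTreePacking_of_integral hx1
    (exists_eq_of_mem_extremePoints_packingPolytope hd hx)
  rw [mul_one] at hk
  refine ⟨k, hk, funext fun m => ?_⟩
  have hq' : (vertexScale d : ℝ) ≠ 0 := by exact_mod_cast hq.ne'
  rw [hkx m, mul_div_cancel_left₀ _ hq']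
  rfl

theorem isRationalPolytope_packingPolytope (hN : N.Nondegenerate) (hM : N.IsMultipleMulticast) :
    IsRationalPolytope N.packingPolytope := by
  refine isRationalPolytope_of_extremePoints (isCompact_packingPolytope hN hM)
    convex_packingPolytope ?_ fun x hx T => ?_
  · rw [packingPolytope_eq]
    exact finite_extremePoints N.abs_packingMatrix_le (isCompact_packing hN hM 1)
  · obtain ⟨z, hz⟩ := exists_eq_of_mem_extremePoints_packingPolytope le_rfl hx T
    have hq : (vertexScale (Fintype.card N.AllSteinerTrees) : ℝ) ≠ 0 := by
      exact_mod_cast (vertexScale_pos _).ne'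
    refine ⟨z / vertexScale (Fintype.card N.AllSteinerTrees), ?_⟩
    push_cast
    rw [← hz, mul_div_cancel_left₀ _ hq]

variable [Finite ν]

theorem isCompact_routingRegion (hN : N.Nondegenerate) (hM : N.IsMultipleMulticast) :
    IsCompact N.routingRegion :=
  routingRegion_eq hN hM ▸ isCompact_image hN hM

theorem convex_routingRegion (hN : N.Nondegenerate) (hM : N.IsMultipleMulticast) :
    Convex ℝ N.routingRegion :=
  routingRegion_eq hN hM ▸ convex_packingPolytope.linear_image N.usagePerMessage

theorem finite_extremePoints_routingRegion (hN : N.Nondegenerate) (hM : N.IsMultipleMulticast) :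
    (N.routingRegion.extremePoints ℝ).Finite := by
  have hfin := finite_extremePoints N.abs_packingMatrix_le (isCompact_packing hN hM 1)
  rw [← packingPolytope_eq] at hfin
  rw [routingRegion_eq hN hM]
  exact (hfin.image _).subset (surjOn_extremePoints_image
    N.usagePerMessage.toContinuousLinearMap.toContinuousAffineMap
    (isCompact_packingPolytope hN hM))

theorem isRationalPolytope_routingRegion (hN : N.Nondegenerate) (hM : N.IsMultipleMulticast) :
    IsRationalPolytope N.routingRegion := by
  refine isRationalPolytope_of_extremePoints (isCompact_routingRegion hN hM)
    (convex_routingRegion hN hM) (finite_extremePoints_routingRegion hN hM) fun y hy m => ?_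
  obtain ⟨k, -, rfl⟩ := exists_hasTreePacking_of_mem_extremePoints hN hM le_rfl hy
  exact ⟨k m / vertexScale (Fintype.card N.AllSteinerTrees), by push_cast; rfl⟩

/-! ### A finite test for vertices -/

/-- If the point `k / q` of the region is the midpoint of a nontrivial segment in the region, then
it is the midpoint of a nontrivial segment whose end points belong to integral packings for the edge
dimension `q * q`: otherwise all vertices of the polytope of pairs of packings whose rates have the
midpoint `k / q`, and hence all its points, would have equal rates. -/
theorem eq_of_add_eq_of_forall_hasTreePacking (hN : N.Nondegenerate)
    (hM : N.IsMultipleMulticast) {d : ℕ} (hd : 2 * Fintype.card N.AllSteinerTrees ≤ d) {k : μ → ℕ}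
    (hk : ∀ k' k'' : μ → ℕ, N.HasTreePacking (vertexScale d * vertexScale d) k' →
      N.HasTreePacking (vertexScale d * vertexScale d) k'' →
        (∀ m, k' m + k'' m = 2 * vertexScale d * k m) → k' = k'')
    {y y' : μ → ℝ} (hy : y ∈ N.routingRegion) (hy' : y' ∈ N.routingRegion)
    (hsum : ∀ m, y m + y' m = 2 * (k m / vertexScale d)) : y = y' := by
  classical
  set q := vertexScale d with hqdef
  have hq : 0 < q := vertexScale_pos d
  have hq' : (0 : ℝ) < q := by exact_mod_cast hq
  rw [routingRegion_eq hN hM] at hy hy'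
  obtain ⟨x, hx, rfl⟩ := hy
  obtain ⟨x', hx', rfl⟩ := hy'
  set K := integralPolyhedron N.pairMatrix (N.pairBound q fun m => 2 * k m) with hKdef
  have hKc : IsCompact K := isCompact_pairPolyhedron hN hM _ _
  -- The difference of the two usages vanishes at the vertices of `K`, hence on `K`.
  let δ : (N.AllSteinerTrees ⊕ N.AllSteinerTrees → ℝ) →ₗ[ℝ] (μ → ℝ) :=
    N.usagePerMessage ∘ₗ LinearMap.funLeft ℝ ℝ Sum.inl
      - N.usagePerMessage ∘ₗ LinearMap.funLeft ℝ ℝ Sum.inr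
  have hδ : ∀ z m, δ z m = N.usagePerMessage (fun T => z (.inl T)) m
      - N.usagePerMessage (fun T => z (.inr T)) m := fun _ _ => rfl
  have hext : K.extremePoints ℝ ⊆ (LinearMap.ker δ : Set _) := by
    intro z hz
    obtain ⟨h1, h2, h3⟩ := mem_pairPolyhedron.1 hz.1
    have hint := vertexScale_mul_integral (d := d) (by
      rw [Fintype.card_sum]
      omega) abs_pairMatrix_le hz
    obtain ⟨k', hk', hkx'⟩ := N.exists_hasTreePacking_of_integral h1 fun T => hint (.inl T)
    obtain ⟨k'', hk'', hkx''⟩ := N.exists_hasTreePacking_of_integral h2 fun T => hint (.inr T)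
    have h4 := hk k' k'' hk' hk'' fun m => by
      have h5 : (k' m : ℝ) + k'' m = 2 * q * k m := by
        rw [hkx', hkx'', ← mul_add, h3 m]
        push_cast
        ring
      exact_mod_cast h5
    refine funext fun m => ?_
    have h6 := hkx' m
    rw [h4, hkx'' m] at h6
    have h7 := mul_left_cancel₀ hq'.ne' h6
    rw [hδ, h7, sub_self]
    rfl
  have hker : K ⊆ (LinearMap.ker δ : Set _) := by
    rw [← convexHull_extremePoints_of_finite hKc (convex_integralPolyhedron _ _)
      (finite_extremePoints abs_pairMatrix_le hKc)]
    exact convexHull_min hext (LinearMap.ker δ).convex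
  have hmem : Sum.elim ((q : ℝ) • x) ((q : ℝ) • x') ∈ K := by
    rw [hKdef, mem_pairPolyhedron]
    refine ⟨(smul_mem_iff N hq).2 hx, (smul_mem_iff N hq).2 hx', fun m => ?_⟩
    have h1 : N.usagePerMessage ((q : ℝ) • x) m + N.usagePerMessage ((q : ℝ) • x') m
        = (2 * k m : ℕ) := by
      rw [map_smul, map_smul, Pi.smul_apply, Pi.smul_apply, smul_eq_mul, smul_eq_mul, ← mul_add,
        hsum m]
      push_cast
      field_simp
    exact h1
  have h := hker hmem
  refine funext fun m => ?_
  have h1 : N.usagePerMessage ((q : ℝ) • x) m - N.usagePerMessage ((q : ℝ) • x') m = 0 :=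
    congrFun h m
  rw [map_smul, map_smul, Pi.smul_apply, Pi.smul_apply, smul_eq_mul, smul_eq_mul, ← mul_sub] at h1
  exact sub_eq_zero.1 ((mul_eq_zero.1 h1).resolve_left hq'.ne')

theorem mem_extremePoints_routingRegion_iff (hN : N.Nondegenerate)
    (hM : N.IsMultipleMulticast) {d : ℕ} (hd : 2 * Fintype.card N.AllSteinerTrees ≤ d) {k : μ → ℕ}
    (hk : N.HasTreePacking (vertexScale d) k) :
    (fun m => (k m : ℝ) / vertexScale d) ∈ N.routingRegion.extremePoints ℝ ↔
      ∀ k' k'' : μ → ℕ, N.HasTreePacking (vertexScale d * vertexScale d) k' →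
        N.HasTreePacking (vertexScale d * vertexScale d) k'' →
          (∀ m, k' m + k'' m = 2 * vertexScale d * k m) → k' = k'' := by
  have hq : 0 < vertexScale d := vertexScale_pos d
  have hq' : (0 : ℝ) < vertexScale d := by exact_mod_cast hq
  constructor
  · intro h k' k'' hk' hk'' hsum
    have h1 := hk'.mem_routingRegion hN hM (Nat.mul_pos hq hq)
    have h2 := hk''.mem_routingRegion hN hM (Nat.mul_pos hq hq)
    have h3 : (fun m => (k m : ℝ) / vertexScale d) ∈ openSegment ℝ
        (fun m => (k' m : ℝ) / (vertexScale d * vertexScale d : ℕ))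
        (fun m => (k'' m : ℝ) / (vertexScale d * vertexScale d : ℕ)) := by
      refine ⟨1 / 2, 1 / 2, by norm_num, by norm_num, by norm_num, funext fun m => ?_⟩
      have h4 : (k' m : ℝ) + k'' m = 2 * vertexScale d * k m := by exact_mod_cast hsum m
      simp only [Pi.add_apply, Pi.smul_apply, smul_eq_mul, Nat.cast_mul]
      field_simp
      linarith
    have h5 := h.2 h1 h2 h3
    funext m
    have h6 := congrFun h5 m
    simp only [Nat.cast_mul] at h6
    field_simp at h6
    have h7 : k' m = vertexScale d * k m := by exact_mod_cast h6
    have h8 := hsum m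
    rw [h7, mul_assoc] at h8
    omega
  · intro h
    refine ⟨hk.mem_routingRegion hN hM hq, fun y hy y' hy' hseg => ?_⟩
    obtain ⟨a, b, ha, hb, hab, hyy⟩ := hseg
    have hconv := convex_routingRegion hN hM
    -- Points of the segment symmetric about the given one.
    set s := min a b
    have hs : 0 < s := lt_min ha hb
    have hsa : s ≤ a := min_le_left _ _
    have hsb : s ≤ b := min_le_right _ _
    have h1 : (a + s) • y + (b - s) • y' ∈ N.routingRegion :=
      hconv hy hy' (by linarith) (by linarith) (by linarith)
    have h2 : (a - s) • y + (b + s) • y' ∈ N.routingRegion :=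
      hconv hy hy' (by linarith) (by linarith) (by linarith)
    have h3 := eq_of_add_eq_of_forall_hasTreePacking hN hM hd h h1 h2 fun m => by
      have h4 := congrFun hyy m
      simp only [Pi.add_apply, Pi.smul_apply, smul_eq_mul] at h4 ⊢
      linarith
    have h5 : y = y' := funext fun m => by
      have h6 := congrFun h3 m
      simp only [Pi.add_apply, Pi.smul_apply, smul_eq_mul] at h6
      have h7 : s * (y m - y' m) = 0 := by linarith
      exact sub_eq_zero.1 ((mul_eq_zero.1 h7).resolve_left hs.ne')
    rw [← hyy, ← h5, ← add_smul, hab, one_smul]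

end Vertices

end CapacitatedNetwork

/-! ### Primitive recursive functions and bounded search -/

-- With `Primrec` registered for `fun_prop`, compositions of the functions below are recognized as
-- primitive recursive automatically.
attribute [fun_prop] Primrec
attribute [fun_prop] Primrec.id Primrec.const Primrec.comp Primrec.pair

namespace Primrec

variable {α β γ : Type*} [Primcodable α] [Primcodable β] [Primcodable γ]

@[fun_prop]
theorem fst_comp {f : α → β × γ} (hf : Primrec f) : Primrec fun a => (f a).1 := fst.comp hf

@[fun_prop]
theorem snd_comp {f : α → β × γ} (hf : Primrec f) : Primrec fun a => (f a).2 := snd.comp hf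

@[fun_prop]
theorem getD_comp {f : α → List β} {g : α → ℕ} {d : β} (hf : Primrec f) (hg : Primrec g) :
    Primrec fun a => (f a).getD (g a) d :=
  (list_getD d).comp hf hg

@[fun_prop]
theorem length_comp {f : α → List β} (hf : Primrec f) : Primrec fun a => (f a).length :=
  list_length.comp hf

@[fun_prop]
theorem range_comp {f : α → ℕ} (hf : Primrec f) : Primrec fun a => List.range (f a) :=
  list_range.comp hf

@[fun_prop]
theorem add_comp {f g : α → ℕ} (hf : Primrec f) (hg : Primrec g) : Primrec fun a => f a + g a :=
  nat_add.comp hf hg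

@[fun_prop]
theorem mul_comp {f g : α → ℕ} (hf : Primrec f) (hg : Primrec g) : Primrec fun a => f a * g a :=
  nat_mul.comp hf hg

@[fun_prop]
theorem pow_comp {f g : α → ℕ} (hf : Primrec f) (hg : Primrec g) : Primrec fun a => f a ^ g a :=
  (nat_rec' hg (const 1) (h := fun a p => p.2 * f a) (by
    change Primrec fun x : α × ℕ × ℕ => x.2.2 * f x.1
    fun_prop)).of_eq fun a => by
    induction g a with
    | zero => rfl
    | succ n ih => exact (congrArg (· * f a) ih).trans (pow_succ _ _).symm

@[fun_prop]
theorem factorial_comp {f : α → ℕ} (hf : Primrec f) : Primrec fun a => (f a).factorial :=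
  (nat_rec' hf (const 1) (h := fun _ p => (p.1 + 1) * p.2) (by
    change Primrec fun x : α × ℕ × ℕ => (x.2.1 + 1) * x.2.2
    fun_prop)).of_eq fun a => by
    induction f a with
    | zero => rfl
    | succ n ih => exact congrArg ((n + 1) * ·) ih

@[fun_prop]
theorem sum_comp {f : α → List ℕ} (hf : Primrec f) : Primrec fun a => (f a).sum :=
  list_foldr hf (const 0) (h := fun _ p => p.1 + p.2) (by
    change Primrec fun x : α × ℕ × ℕ => x.2.1 + x.2.2
    fun_prop)

theorem map_comp {f : α → List β} {g : α → β → γ} (hf : Primrec f)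
    (hg : Primrec fun x : α × β => g x.1 x.2) : Primrec fun a => (f a).map (g a) :=
  list_map hf hg

theorem flatMap_comp {f : α → List β} {g : α → β → List γ} (hf : Primrec f)
    (hg : Primrec fun x : α × β => g x.1 x.2) : Primrec fun a => (f a).flatMap (g a) :=
  list_flatMap hf hg

end Primrec

namespace PrimrecPred

variable {α β : Type*} [Primcodable α] [Primcodable β]

theorem imp {p q : α → Prop} (hp : PrimrecPred p) (hq : PrimrecPred q) :
    PrimrecPred fun a => p a → q a :=
  (hp.not.or hq).of_eq fun _ => imp_iff_not_or.symm

theorem exists_mem {f : α → List β} {p : α → β → Prop} (hf : Primrec f)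
    (hp : PrimrecPred fun x : α × β => p x.1 x.2) : PrimrecPred fun a => ∃ b ∈ f a, p a b :=
  (PrimrecRel.exists_mem_list (R := fun b a => p a b)
    (hp.comp (Primrec.snd.pair Primrec.fst))).comp hf Primrec.id

theorem forall_mem {f : α → List β} {p : α → β → Prop} (hf : Primrec f)
    (hp : PrimrecPred fun x : α × β => p x.1 x.2) : PrimrecPred fun a => ∀ b ∈ f a, p a b :=
  (PrimrecRel.forall_mem_list (R := fun b a => p a b)
    (hp.comp (Primrec.snd.pair Primrec.fst))).comp hf Primrec.id

theorem mem_list {f : α → List β} {g : α → β} (hf : Primrec f) (hg : Primrec g) :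
    PrimrecPred fun a => g a ∈ f a :=
  (exists_mem (p := fun a b => b = g a) hf
    (Primrec.eq.comp Primrec.snd (hg.comp Primrec.fst))).of_eq fun a => by simp

end PrimrecPred

/-- All lists of length at most `ℓ` with entries in the list `s`. -/
def boundedLists {α : Type*} (s : List α) : ℕ → List (List α)
  | 0 => [[]]
  | ℓ + 1 => [] :: s.flatMap fun b => (boundedLists s ℓ).map fun l => b :: l

theorem mem_boundedLists {α : Type*} {s : List α} {ℓ : ℕ} {l : List α} :
    l ∈ boundedLists s ℓ ↔ l.length ≤ ℓ ∧ ∀ b ∈ l, b ∈ s := by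
  induction ℓ generalizing l with
  | zero =>
    rw [boundedLists, List.mem_singleton, Nat.le_zero, List.length_eq_zero_iff]
    constructor
    · rintro rfl
      simp
    · exact And.left
  | succ ℓ ih =>
    cases l with
    | nil => simp [boundedLists]
    | cons b l =>
      simp only [boundedLists, List.mem_cons, List.mem_flatMap, List.mem_map, ih]
      constructor
      · rintro (h | ⟨b', hb', l', ⟨h1, h2⟩, h3⟩)
        · exact absurd h (List.cons_ne_nil _ _)
        · obtain ⟨rfl, rfl⟩ := List.cons.inj h3
          refine ⟨Nat.succ_le_succ h1, ?_⟩
          rintro x (rfl | hx)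
          · exact hb'
          · exact h2 x hx
      · rintro ⟨h1, h2⟩
        exact Or.inr ⟨b, h2 b (Or.inl rfl), l,
          ⟨Nat.le_of_succ_le_succ h1, fun x hx => h2 x (Or.inr hx)⟩, rfl⟩

theorem Primrec.boundedLists_comp {α β : Type*} [Primcodable α] [Primcodable β] {f : α → List β}
    {g : α → ℕ} (hf : Primrec f) (hg : Primrec g) :
    Primrec fun a => boundedLists (f a) (g a) :=
  (Primrec.nat_rec' hg (Primrec.const [[]])
    (h := fun a p => [] :: (f a).flatMap fun b => p.2.map fun l => b :: l) (by
      change Primrec fun x : α × ℕ × List (List β) =>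
        [] :: (f x.1).flatMap fun b => x.2.2.map fun l => b :: l
      refine Primrec.list_cons.comp (Primrec.const []) (Primrec.flatMap_comp (by fun_prop) ?_)
      exact Primrec.map_comp (by fun_prop)
        (Primrec.list_cons.comp (by fun_prop) (by fun_prop)))).of_eq fun a => by
    induction g a with
    | zero => rfl
    | succ n ih =>
      exact congrArg (fun L : List (List β) =>
        [] :: (f a).flatMap fun b => L.map fun l => b :: l) ih

/-! ### The algorithm -/

namespace NetworkDescription

/-- The start node of the edge number `e`. Here and below, numbers outside the range of the
description lead to default values. -/
def src (D : NetworkDescription) (e : ℕ) : ℕ := (D.2.2.2.1.getD e (0, 0, 0)).1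

/-- The end node of the edge number `e`. -/
def tgt (D : NetworkDescription) (e : ℕ) : ℕ := (D.2.2.2.1.getD e (0, 0, 0)).2.1

/-- The capacity of the edge number `e`. -/
def cap (D : NetworkDescription) (e : ℕ) : ℕ := (D.2.2.2.1.getD e (0, 0, 0)).2.2

/-- The node number `x` generates the message number `m`. -/
def Generates (D : NetworkDescription) (x m : ℕ) : Prop :=
  (D.2.2.2.2.1.getD x []).getD m false = true

/-- The node number `x` demands the message number `m`. -/
def Demands (D : NetworkDescription) (x m : ℕ) : Prop :=
  (D.2.2.2.2.2.getD x []).getD m false = true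

/-- The labels `(m, j)` used for a rate vector `k`. For simplicity `j` runs up to the sum of `k`, so
that all coordinates `j < k m` of each message `m` are included. -/
def labels (D : NetworkDescription) (k : List ℕ) : List (ℕ × ℕ) :=
  (List.range D.2.1).flatMap fun m => (List.range k.sum).map fun j => (m, j)

/-- The list `L` assigns to each edge a list of labels `(m, j)`, meaning that the edge carries the
`j`-th coordinate of the message `m`. Capacities are respected for the edge dimension `n`, the
message of a label on an edge is generated at its start node or the label is present on some
in-edge of the start node, and all labels demanded for the rate vector `k` arrive. -/
def IsLabelling (D : NetworkDescription) (n : ℕ) (k : List ℕ) (L : List (List (ℕ × ℕ))) : Prop :=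
  (∀ e ∈ List.range D.2.2.2.1.length, (L.getD e []).length ≤ n * D.cap e) ∧
  (∀ e ∈ List.range D.2.2.2.1.length, ∀ l ∈ L.getD e [], D.Generates (D.src e) l.1 ∨
    ∃ e' ∈ List.range D.2.2.2.1.length, D.tgt e' = D.src e ∧ l ∈ L.getD e' []) ∧
  ∀ x ∈ List.range D.1, ∀ m ∈ List.range D.2.1, D.Demands x m →
    ∀ j ∈ List.range (k.getD m 0), ∃ e ∈ List.range D.2.2.2.1.length,
      D.tgt e = x ∧ (m, j) ∈ L.getD e []

/-- The vector `k` has the right length and is the rate vector of a labelling. An edge needs no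
label twice, so that its list of labels may be taken to be at most as long as the list of all
labels. -/
def Feasible (D : NetworkDescription) (n : ℕ) (k : List ℕ) : Prop :=
  k.length = D.2.1 ∧
    ∃ L ∈ boundedLists (boundedLists (D.labels k) (D.labels k).length) D.2.2.2.1.length,
      D.IsLabelling n k L

/-- A finite list containing all feasible rate vectors for the edge dimension `n`: since each tree
uses an edge, no entry exceeds `n` times the sum of all capacities. -/
def candidates (D : NetworkDescription) (n : ℕ) : List (List ℕ) :=
  boundedLists (List.range (n * (D.2.2.2.1.map fun e => e.2.2).sum + 1)) D.2.1

/-- An edge dimension for which all vertices of the capacity region are rate vectors. There are at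
most `2 ^ d` Steiner trees for each of the messages, where `d` is the number of edges; the factor
`2` accounts for pairs of packings. -/
def scale (D : NetworkDescription) : ℕ := vertexScale (2 * (D.2.1 * 2 ^ D.2.2.2.1.length))

/-- The vector `k` is feasible for the edge dimension `q`, the scale of the description, and its
multiple `q * k` is not the midpoint of two different feasible vectors for the edge dimension
`q * q`. -/
def IsVertexRate (D : NetworkDescription) (k : List ℕ) : Prop :=
  D.Feasible D.scale k ∧
    ∀ k' ∈ D.candidates (D.scale * D.scale), ∀ k'' ∈ D.candidates (D.scale * D.scale),
      D.Feasible (D.scale * D.scale) k' → D.Feasible (D.scale * D.scale) k'' →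
        (∀ m ∈ List.range D.2.1, k'.getD m 0 + k''.getD m 0 = 2 * D.scale * k.getD m 0) → k' = k''

open Classical in
/-- The list of the vertices of the capacity region, as fractions with the scale as denominator. -/
noncomputable def vertexList (D : NetworkDescription) : List (List (ℕ × ℕ)) :=
  (D.candidates D.scale).flatMap fun k =>
    if D.IsVertexRate k then [k.map fun a => (a, D.scale)] else []

section Primrec

variable {α : Type*} [Primcodable α] {D : α → NetworkDescription}

@[fun_prop]
theorem primrec_src {e : α → ℕ} (hD : Primrec D) (he : Primrec e) :
    Primrec fun a => (D a).src (e a) := by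
  unfold src
  fun_prop

@[fun_prop]
theorem primrec_tgt {e : α → ℕ} (hD : Primrec D) (he : Primrec e) :
    Primrec fun a => (D a).tgt (e a) := by
  unfold tgt
  fun_prop

@[fun_prop]
theorem primrec_cap {e : α → ℕ} (hD : Primrec D) (he : Primrec e) :
    Primrec fun a => (D a).cap (e a) := by
  unfold cap
  fun_prop

theorem primrecPred_generates {x m : α → ℕ} (hD : Primrec D) (hx : Primrec x) (hm : Primrec m) :
    PrimrecPred fun a => (D a).Generates (x a) (m a) :=
  Primrec.eq.comp (by fun_prop) (Primrec.const true)

theorem primrecPred_demands {x m : α → ℕ} (hD : Primrec D) (hx : Primrec x) (hm : Primrec m) :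
    PrimrecPred fun a => (D a).Demands (x a) (m a) :=
  Primrec.eq.comp (by fun_prop) (Primrec.const true)

@[fun_prop]
theorem primrec_labels {k : α → List ℕ} (hD : Primrec D) (hk : Primrec k) :
    Primrec fun a => (D a).labels (k a) :=
  Primrec.flatMap_comp (by fun_prop) (Primrec.map_comp (by fun_prop) (by fun_prop))

@[fun_prop]
theorem primrec_scale (hD : Primrec D) : Primrec fun a => (D a).scale := by
  unfold scale vertexScale
  fun_prop

@[fun_prop]
theorem primrec_candidates {n : α → ℕ} (hD : Primrec D) (hn : Primrec n) :
    Primrec fun a => (D a).candidates (n a) := by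
  have h : Primrec fun a => (D a).2.2.2.1.map fun e => e.2.2 :=
    Primrec.map_comp (by fun_prop) (by fun_prop)
  exact Primrec.boundedLists_comp (by fun_prop) (by fun_prop)

theorem primrecPred_isLabelling {n : α → ℕ} {k : α → List ℕ} {L : α → List (List (ℕ × ℕ))}
    (hD : Primrec D) (hn : Primrec n) (hk : Primrec k) (hL : Primrec L) :
    PrimrecPred fun a => (D a).IsLabelling (n a) (k a) (L a) := by
  refine .and (.forall_mem (by fun_prop) (Primrec.nat_le.comp (by fun_prop) (by fun_prop)))
    (.and (.forall_mem (by fun_prop) (.forall_mem (by fun_prop) (.or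
      (primrecPred_generates (by fun_prop) (by fun_prop) (by fun_prop))
      (.exists_mem (by fun_prop) (.and (Primrec.eq.comp (by fun_prop) (by fun_prop))
        (.mem_list (by fun_prop) (by fun_prop)))))))
      (.forall_mem (by fun_prop) (.forall_mem (by fun_prop) (.imp
        (primrecPred_demands (by fun_prop) (by fun_prop) (by fun_prop))
        (.forall_mem (by fun_prop) (.exists_mem (by fun_prop) (.and
          (Primrec.eq.comp (by fun_prop) (by fun_prop))
          (.mem_list (by fun_prop) (by fun_prop)))))))))

theorem primrecPred_feasible {n : α → ℕ} {k : α → List ℕ} (hD : Primrec D) (hn : Primrec n)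
    (hk : Primrec k) : PrimrecPred fun a => (D a).Feasible (n a) (k a) :=
  .and (Primrec.eq.comp (by fun_prop) (by fun_prop))
    (.exists_mem (Primrec.boundedLists_comp (Primrec.boundedLists_comp (by fun_prop) (by fun_prop))
      (by fun_prop)) (primrecPred_isLabelling (by fun_prop) (by fun_prop) (by fun_prop)
        (by fun_prop)))

theorem primrecPred_isVertexRate {k : α → List ℕ} (hD : Primrec D) (hk : Primrec k) :
    PrimrecPred fun a => (D a).IsVertexRate (k a) :=
  .and (primrecPred_feasible (by fun_prop) (by fun_prop) (by fun_prop))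
    (.forall_mem (by fun_prop) (.forall_mem (by fun_prop) (.imp
      (primrecPred_feasible (by fun_prop) (by fun_prop) (by fun_prop)) (.imp
        (primrecPred_feasible (by fun_prop) (by fun_prop) (by fun_prop)) (.imp
          (.forall_mem (by fun_prop) (Primrec.eq.comp (by fun_prop) (by fun_prop)))
          (Primrec.eq.comp (by fun_prop) (by fun_prop)))))))

theorem primrec_vertexList : Primrec vertexList := by
  classical
  exact Primrec.flatMap_comp (by fun_prop) (Primrec.ite
    (primrecPred_isVertexRate (by fun_prop) (by fun_prop))
    (Primrec.list_cons.comp (Primrec.map_comp (by fun_prop) (by fun_prop)) (Primrec.const []))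
    (Primrec.const []))

end Primrec

end NetworkDescription

namespace CapacitatedNetwork

theorem HasTreePacking.le_sum {ν ε μ 𝒜 : Type*} [Fintype ε] [Fintype μ]
    {N : CapacitatedNetwork ν ε μ 𝒜} (hN : N.Nondegenerate) (hM : N.IsMultipleMulticast) {n : ℕ}
    {k : μ → ℕ} (h : N.HasTreePacking n k) (m : μ) : k m ≤ n * ∑ e, (N.c e : ℕ) := by
  classical
  obtain ⟨x, hx, hk⟩ := h
  calc k m = ∑ T : N.SteinerTree m, x ⟨m, T⟩ := (hk m).symm
    _ ≤ ∑ m, ∑ T : N.SteinerTree m, x ⟨m, T⟩ :=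
        Finset.single_le_sum (f := fun m => ∑ T : N.SteinerTree m, x ⟨m, T⟩)
          (fun _ _ => Nat.zero_le _) (Finset.mem_univ m)
    _ = ∑ T : N.AllSteinerTrees, x T := (Fintype.sum_sigma _).symm
    _ ≤ ∑ T : N.AllSteinerTrees, ∑ e, (if e ∈ T.2.1 then 1 else 0) * x T := by
        refine Finset.sum_le_sum fun T _ => ?_
        obtain ⟨e, he⟩ := T.2.exists_mem hN hM
        have h := Finset.single_le_sum (f := fun e => (if e ∈ T.2.1 then 1 else 0) * x T)
          (fun _ _ => Nat.zero_le _) (Finset.mem_univ e)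
        simpa [he] using h
    _ = ∑ e, ∑ T : N.AllSteinerTrees, (if e ∈ T.2.1 then 1 else 0) * x T := Finset.sum_comm
    _ ≤ ∑ e, n * (N.c e : ℕ) := Finset.sum_le_sum fun e _ => hx e
    _ = _ := Finset.mul_sum _ _ _ |>.symm

/-! ### Correctness of the algorithm -/

section Correctness

variable {v d p q : ℕ} (N : CapacitatedNetwork (Fin v) (Fin d) (Fin p) (Fin q))

theorem length_edges_description : N.description.2.2.2.1.length = d := by
  simp [description]

theorem src_description (e : Fin d) : N.description.src e = N.src e := by
  simp [NetworkDescription.src, description]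

theorem tgt_description (e : Fin d) : N.description.tgt e = N.tgt e := by
  simp [NetworkDescription.tgt, description]

theorem cap_description (e : Fin d) : N.description.cap e = N.c e := by
  simp [NetworkDescription.cap, description]

theorem generates_description (x : Fin v) (m : Fin p) :
    N.description.Generates x m ↔ m ∈ N.S x := by
  simp [NetworkDescription.Generates, description]

theorem demands_description (x : Fin v) (m : Fin p) :
    N.description.Demands x m ↔ m ∈ N.R x := by
  simp [NetworkDescription.Demands, description]

theorem forall_mem_range_iff {n : ℕ} {P : ℕ → Prop} :
    (∀ i ∈ List.range n, P i) ↔ ∀ i : Fin n, P i := by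
  simp [Fin.forall_iff]

theorem exists_mem_range_iff {n : ℕ} {P : ℕ → Prop} :
    (∃ i ∈ List.range n, P i) ↔ ∃ i : Fin n, P i := by
  simp [Fin.exists_iff]

theorem isLabelling_description_iff {n : ℕ} {k : Fin p → ℕ} {L : List (List (ℕ × ℕ))} :
    N.description.IsLabelling n (List.ofFn k) L ↔
      (∀ e : Fin d, (L.getD e []).length ≤ n * N.c e) ∧
      (∀ e : Fin d, ∀ l ∈ L.getD e [], N.description.Generates (N.src e) l.1 ∨
        ∃ e' : Fin d, N.tgt e' = N.src e ∧ l ∈ L.getD e' []) ∧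
      ∀ x, ∀ m, m ∈ N.R x → ∀ j : Fin (k m), ∃ e : Fin d,
        N.tgt e = x ∧ ((m : ℕ), (j : ℕ)) ∈ L.getD e [] := by
  have hk : ∀ (m : Fin p) (P : ℕ → Prop), (∀ j : Fin ((List.ofFn k).getD m 0), P j) ↔
      ∀ j : Fin (k m), P j := fun m P => by
    rw [← forall_mem_range_iff, ← forall_mem_range_iff]
    simp
  have hp : N.description.2.1 = p := rfl
  have hv : N.description.1 = v := rfl
  simp only [NetworkDescription.IsLabelling, length_edges_description, hp, hv, forall_mem_range_iff,
    exists_mem_range_iff, src_description, tgt_description, cap_description, demands_description,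
    Fin.val_inj]
  exact and_congr_right' (and_congr_right' (forall_congr' fun x => forall_congr' fun m =>
    imp_congr_right fun _ => hk m fun j => ∃ e : Fin d, N.tgt e = x ∧ ((m : ℕ), j) ∈ L.getD e []))

theorem injective_label_val {k : Fin p → ℕ} :
    Function.Injective fun l : Σ m, Fin (k m) => ((l.1 : ℕ), (l.2 : ℕ)) := by
  rintro ⟨⟨m, hm⟩, ⟨j, hj⟩⟩ ⟨⟨m', hm'⟩, ⟨j', hj'⟩⟩ h
  obtain ⟨h1, h2⟩ := Prod.mk.inj h
  dsimp only at h1 h2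
  subst h1 h2
  rfl

theorem mem_labels_description {k : Fin p → ℕ} (m : Fin p) (j : Fin (k m)) :
    ((m : ℕ), (j : ℕ)) ∈ N.description.labels (List.ofFn k) := by
  have h : k m ≤ (List.ofFn k).sum := by
    rw [List.sum_ofFn]
    exact Finset.single_le_sum (fun _ _ => Nat.zero_le _) (Finset.mem_univ m)
  simp only [NetworkDescription.labels, List.mem_flatMap, List.mem_map, List.mem_range]
  exact ⟨m, m.2, j, j.2.trans_le h, rfl⟩

variable {N}

/-- A labelling amounts to a packing of Steiner trees: the edges with a given label contain a
Steiner tree, and conversely each edge is labelled by the coordinates whose tree contains it. -/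
theorem feasible_description_iff (hN : N.Nondegenerate) (hM : N.IsMultipleMulticast) {n : ℕ}
    {k : Fin p → ℕ} :
    N.description.Feasible n (List.ofFn k) ↔ N.HasTreePacking n k := by
  classical
  rw [hasTreePacking_iff]
  constructor
  · rintro ⟨-, L, -, hL⟩
    obtain ⟨h1, h2, h3⟩ := (N.isLabelling_description_iff).1 hL
    have h : ∀ m (j : Fin (k m)), ∃ T : N.SteinerTree m,
        (T.1 : Set (Fin d)) ⊆ {e | ((m : ℕ), (j : ℕ)) ∈ L.getD e []} := by
      intro m j
      refine hM.exists_steinerTree_subset (fun e he => ?_) fun x hx => ?_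
      · exact (h2 e _ he).imp (N.generates_description _ m).1
          fun ⟨e', h4, h5⟩ => ⟨e', h5, h4⟩
      · obtain ⟨e, h4, h5⟩ := h3 x m hx j
        exact Or.inr ⟨e, h5, h4⟩
    choose τ hτ using h
    have hcard : ∀ e, (Finset.univ.filter fun l : Σ m, Fin (k m) => e ∈ (τ l.1 l.2).1).card
        ≤ n * N.c e := by
      intro e
      refine le_trans ?_ ((List.toFinset_card_le (L.getD e [])).trans (h1 e))
      refine Finset.card_le_card_of_injOn (fun l => ((l.1 : ℕ), (l.2 : ℕ))) (fun l hl => ?_)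
        injective_label_val.injOn
      exact Finset.mem_coe.2 (List.mem_toFinset.2 (hτ l.1 l.2 (Finset.mem_filter.1 hl).2))
    exact ⟨τ, fun e => by convert hcard e⟩
  · rintro ⟨τ, hτ⟩
    let lab : Fin d → List (ℕ × ℕ) := fun e =>
      (Finset.univ.filter fun l : Σ m, Fin (k m) => e ∈ (τ l.1 l.2).1).toList.map
        fun l => ((l.1 : ℕ), (l.2 : ℕ))
    have hmem : ∀ e l, l ∈ lab e ↔
        ∃ m, ∃ j : Fin (k m), e ∈ (τ m j).1 ∧ ((m : ℕ), (j : ℕ)) = l := by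
      intro e l
      simp [lab, Sigma.exists]
    have hlen : ∀ e, (lab e).length ≤ n * N.c e := by
      intro e
      rw [List.length_map, Finset.length_toList]
      convert hτ e
    have hnodup : ∀ e, (lab e).Nodup := fun e => (Finset.nodup_toList _).map injective_label_val
    have hsub : ∀ e, ∀ l ∈ lab e, l ∈ N.description.labels (List.ofFn k) := by
      intro e l hl
      obtain ⟨m, j, -, rfl⟩ := (hmem e l).1 hl
      exact N.mem_labels_description m j
    have hget : ∀ e : Fin d, (List.ofFn lab).getD e [] = lab e := fun e => by simp
    refine ⟨by simp [description], List.ofFn lab, mem_boundedLists.2 ⟨?_, ?_⟩, ?_⟩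
    · rw [List.length_ofFn, length_edges_description]
    · intro b hb
      obtain ⟨e, rfl⟩ := List.mem_ofFn.1 hb
      exact mem_boundedLists.2 ⟨(List.subperm_of_subset (hnodup e) (hsub e)).length_le, hsub e⟩
    · rw [isLabelling_description_iff]
      simp only [hget]
      refine ⟨hlen, fun e l hl => ?_, fun x m hx j => ?_⟩
      · obtain ⟨m, j, he, rfl⟩ := (hmem e l).1 hl
        obtain ⟨s, hs, hT⟩ := (τ m j).2
        rcases (hT.2.2.1 e he).cases_edge with rfl | ⟨e', he', h4, -⟩
        · exact Or.inl ((N.generates_description _ m).2 hs)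
        · exact Or.inr ⟨e', h4, (hmem e' _).2 ⟨m, j, he', rfl⟩⟩
      · obtain ⟨s, hs, hT⟩ := (τ m j).2
        rcases (hT.2.2.2 x hx).cases_edge with rfl | ⟨e, he, h4, -⟩
        · exact absurd hx (hN.2 s m hs)
        · exact ⟨e, h4, (hmem e _).2 ⟨m, j, he, rfl⟩⟩

theorem HasTreePacking.mem_candidates (hN : N.Nondegenerate) (hM : N.IsMultipleMulticast) {n : ℕ}
    {k : Fin p → ℕ} (h : N.HasTreePacking n k) :
    List.ofFn k ∈ N.description.candidates n := by
  refine mem_boundedLists.2 ⟨by simp [description], fun b hb => ?_⟩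
  obtain ⟨m, rfl⟩ := List.mem_ofFn.1 hb
  have h1 : (N.description.2.2.2.1.map fun e => e.2.2).sum = ∑ e, (N.c e : ℕ) := by
    simp [description, List.map_ofFn, List.sum_ofFn]
  rw [h1, List.mem_range]
  exact Nat.lt_succ_of_le (h.le_sum hN hM m)

theorem exists_eq_ofFn {l : List ℕ} (h : l.length = p) : ∃ k : Fin p → ℕ, l = List.ofFn k := by
  subst h
  exact ⟨l.get, (List.ofFn_get l).symm⟩

variable (N) in
theorem two_mul_card_allSteinerTrees_le :
    2 * Fintype.card N.AllSteinerTrees ≤ 2 * (p * 2 ^ d) := by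
  refine Nat.mul_le_mul_left 2 ?_
  rw [Fintype.card_sigma]
  have h : ∀ m ∈ (Finset.univ : Finset (Fin p)), Fintype.card (N.SteinerTree m) ≤ 2 ^ d := by
    intro m _
    have h1 := Fintype.card_le_of_injective (Subtype.val : N.SteinerTree m → Finset (Fin d))
      Subtype.val_injective
    simpa using h1
  simpa using Finset.sum_le_card_nsmul _ _ _ h

theorem isVertexRate_description_iff (hN : N.Nondegenerate) (hM : N.IsMultipleMulticast)
    {k : Fin p → ℕ} :
    N.description.IsVertexRate (List.ofFn k) ↔ N.HasTreePacking N.description.scale k ∧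
      (fun m => (k m : ℝ) / N.description.scale) ∈ N.routingRegion.extremePoints ℝ := by
  have hscale : N.description.scale = vertexScale (2 * (p * 2 ^ d)) := by
    rw [NetworkDescription.scale, length_edges_description]
    rfl
  have hp : N.description.2.1 = p := rfl
  have hget : ∀ (k : Fin p → ℕ) (m : Fin p), (List.ofFn k).getD m 0 = k m := fun k m => by simp
  rw [NetworkDescription.IsVertexRate, feasible_description_iff hN hM, hscale]
  refine and_congr_right fun hk => ?_
  rw [mem_extremePoints_routingRegion_iff hN hM N.two_mul_card_allSteinerTrees_le hk]
  constructor
  · intro h k' k'' hk' hk'' hsum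
    refine List.ofFn_injective (h _ (hk'.mem_candidates hN hM) _ (hk''.mem_candidates hN hM)
      ((feasible_description_iff hN hM).2 hk') ((feasible_description_iff hN hM).2 hk'') ?_)
    rw [hp, forall_mem_range_iff]
    intro m
    rw [hget, hget, hget]
    exact hsum m
  · intro h l' _ l'' _ hl' hl'' hsum
    obtain ⟨k', rfl⟩ := exists_eq_ofFn (hl'.1.trans hp)
    obtain ⟨k'', rfl⟩ := exists_eq_ofFn (hl''.1.trans hp)
    rw [hp, forall_mem_range_iff] at hsum
    refine congrArg List.ofFn (h k' k'' ((feasible_description_iff hN hM).1 hl')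
      ((feasible_description_iff hN hM).1 hl'') fun m => ?_)
    have h1 := hsum m
    rwa [hget, hget, hget] at h1

theorem mem_vertexList_description_iff (hN : N.Nondegenerate) (hM : N.IsMultipleMulticast)
    {l : List (ℕ × ℕ)} :
    l ∈ N.description.vertexList ↔ ∃ k : Fin p → ℕ,
      (N.HasTreePacking N.description.scale k ∧
        (fun m => (k m : ℝ) / N.description.scale) ∈ N.routingRegion.extremePoints ℝ) ∧
      l = List.ofFn fun m => (k m, N.description.scale) := by
  classical
  rw [NetworkDescription.vertexList, List.mem_flatMap]
  constructor
  · rintro ⟨l', -, h⟩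
    by_cases hl' : N.description.IsVertexRate l'
    · rw [if_pos hl', List.mem_singleton] at h
      obtain ⟨k, rfl⟩ := exists_eq_ofFn (p := p) hl'.1.1
      refine ⟨k, (isVertexRate_description_iff hN hM).1 hl', ?_⟩
      rw [h, List.map_ofFn]
      rfl
    · rw [if_neg hl'] at h
      exact absurd h List.not_mem_nil
  · rintro ⟨k, hk, rfl⟩
    refine ⟨List.ofFn k, hk.1.mem_candidates hN hM, ?_⟩
    rw [if_pos ((isVertexRate_description_iff hN hM).2 hk), List.mem_singleton, List.map_ofFn]
    rfl

theorem fractionVector_ofFn (k : Fin p → ℕ) (n : ℕ) :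
    fractionVector p (List.ofFn fun m => (k m, n)) = fun m => (k m : ℝ) / n := by
  funext m
  simp [fractionVector]

theorem image_vertexList_description (hN : N.Nondegenerate) (hM : N.IsMultipleMulticast) :
    fractionVector p '' {l | l ∈ N.description.vertexList} =
      N.routingRegion.extremePoints ℝ := by
  have hscale : N.description.scale = vertexScale (2 * (p * 2 ^ d)) := by
    rw [NetworkDescription.scale, length_edges_description]
    rfl
  ext y
  constructor
  · rintro ⟨l, hl, rfl⟩
    obtain ⟨k, hk, rfl⟩ := (mem_vertexList_description_iff hN hM).1 hl
    rw [fractionVector_ofFn]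
    exact hk.2
  · intro hy
    have hd := N.two_mul_card_allSteinerTrees_le
    obtain ⟨k, hk, rfl⟩ := exists_hasTreePacking_of_mem_extremePoints hN hM
      (d := 2 * (p * 2 ^ d)) (by omega) hy
    rw [← hscale] at hk hy ⊢
    exact ⟨_, (mem_vertexList_description_iff hN hM).2 ⟨k, ⟨hk, hy⟩, rfl⟩,
      fractionVector_ofFn k _⟩

theorem isFractionVector_of_mem_vertexList (hN : N.Nondegenerate) (hM : N.IsMultipleMulticast)
    {l : List (ℕ × ℕ)} (hl : l ∈ N.description.vertexList) : IsFractionVector p l := by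
  obtain ⟨k, -, rfl⟩ := (mem_vertexList_description_iff hN hM).1 hl
  refine ⟨List.length_ofFn, fun z hz => ?_⟩
  obtain ⟨m, rfl⟩ := List.mem_ofFn.1 hz
  exact vertexScale_pos _

end Correctness

end CapacitatedNetwork

theorem mainTheorem5 :
    (∀ (ν ε μ 𝒜 : Type*) [Finite ν] [Finite ε] [Fintype μ] (N : CapacitatedNetwork ν ε μ 𝒜),
      N.Nondegenerate → N.IsMultipleMulticast →
        -- the region is a bounded rational polytope in the nonnegative orthant
        (Bornology.IsBounded N.routingRegion ∧ IsRationalPolytope N.routingRegion ∧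
          (∀ r ∈ N.routingRegion, ∀ m, 0 ≤ r m)) ∧
        -- a minimal routing solution routes every message coordinate along a Steiner tree, uses no
        -- other edge coordinates, and gives, after scaling by `n`, a point of the packing polytope
        (∀ (F : Type) (_ : Field F) (_ : Finite F) (k : μ → ℕ) (n : ℕ) (C : N.FractionalCode F k n),
          C.IsMinimalRoutingSolution →
            ∃ τ : ∀ m, Fin (k m) → N.SteinerTree m,
              (∀ e m j, e ∈ (τ m j).1 → ∃! t, C.Carries e t m j) ∧
              (∀ e t, ⟨e, t⟩ ∈ C.active → ∃ m j, e ∈ (τ m j).1 ∧ C.Carries e t m j) ∧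
              CapacitatedNetwork.treeUsage n τ ∈ N.packingPolytope ∧
              N.usagePerMessage (CapacitatedNetwork.treeUsage n τ) = fun m => (k m : ℝ) / n) ∧
        -- the region is the image of the packing polytope
        IsRationalPolytope N.packingPolytope ∧
        N.routingRegion = N.usagePerMessage '' N.packingPolytope) ∧
    -- one algorithm computes, for every network, the vertices of the region
    ∃ f : NetworkDescription → List (List (ℕ × ℕ)), Computable f ∧
      ∀ (v d p q : ℕ) (N : CapacitatedNetwork (Fin v) (Fin d) (Fin p) (Fin q)),
        N.Nondegenerate → N.IsMultipleMulticast →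
          (∀ l ∈ f N.description, IsFractionVector p l) ∧
          fractionVector p '' {l | l ∈ f N.description} = N.routingRegion.extremePoints ℝ ∧
          N.routingRegion = convexHull ℝ (fractionVector p '' {l | l ∈ f N.description}) := by
  classical
  refine ⟨?_, NetworkDescription.vertexList, NetworkDescription.primrec_vertexList.to_comp, ?_⟩
  · intro ν ε μ 𝒜 _ _ _ N hN hM
    have himage := CapacitatedNetwork.routingRegion_eq hN hM
    refine ⟨⟨(CapacitatedNetwork.isCompact_routingRegion hN hM).isBounded,
      CapacitatedNetwork.isRationalPolytope_routingRegion hN hM, fun r hr m => ?_⟩, ?_,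
      CapacitatedNetwork.isRationalPolytope_packingPolytope hN hM, himage⟩
    · rw [himage] at hr
      obtain ⟨x, hx, rfl⟩ := hr
      exact Finset.sum_nonneg fun T _ => hx.2 _
    · intro F _ _ k n C hC
      obtain ⟨τ, h1, h2⟩ := hC.exists_trees hM
      obtain ⟨slot, -, hinj⟩ :=
        CapacitatedNetwork.FractionalCode.exists_injOn_slots fun m j e he => (h1 e m j he).exists
      exact ⟨τ, h1, h2, CapacitatedNetwork.treeUsage_mem_packingPolytope C.n_pos fun e =>
        CapacitatedNetwork.card_filter_le_of_injOn (hinj e),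
        CapacitatedNetwork.usagePerMessage_treeUsage τ⟩
  · intro v d p q N hN hM
    refine ⟨fun l hl => CapacitatedNetwork.isFractionVector_of_mem_vertexList hN hM hl,
      CapacitatedNetwork.image_vertexList_description hN hM, ?_⟩
    rw [CapacitatedNetwork.image_vertexList_description hN hM,
      convexHull_extremePoints_of_finite (CapacitatedNetwork.isCompact_routingRegion hN hM)
        (CapacitatedNetwork.convex_routingRegion hN hM)
        (CapacitatedNetwork.finite_extremePoints_routingRegion hN hM)]
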